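/- **Lemma 2.2 (concentration of the $\ell^4$-norm over the orthogonal group).** For $\theta\in(0,1)$ let $\mathrm{BG}(\theta)$ be the law of $b\,g$ with $b\sim\mathrm{Ber}(\theta)$ and $g\sim\mathcal N(0,1)$ independent. For integers $n,p\ge 1$ let $X\in\mathbb R^{n\times p}$ be a random matrix with i.i.d. $\mathrm{BG}(\theta)$ entries, let $\|A\|_4^4=\sum_{i,j}a_{i,j}^4$, and put $$\Delta=\sup_{W\in O(n)}\frac1{np}\Big|\,\|WX\|_4^4-\mathbb E\|WX\|_4^4\,\Big| .$$ 1. (Explicit tail bound.) There are absolute constants $c_1>10^4$ and $c_2>3360$ such that for all $n\ge1$, $p\ge2$, $\theta\in(0,1)$ and $\delta>0$, $$\mathbb P(\Delta\ge\delta)<\exp\Big(-\frac{3p\delta^2}{c_1\theta+8n(\ln p)^4\delta}+n^2\ln\frac{60np(\ln p)^4}{\delta}\Big)+\exp\Big(-\frac{p\delta^2}{c_2\theta}+n^2\ln\frac{60np(\ln p)^4}{\delta}\Big)+2np\theta\, e^{-(\ln p)^2/2}.$$ 2. ($\mathbb P(\Delta\ge\delta)<1/p$ when $p=\Omega(\theta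 n^2\ln n/\delta^2)$.) For every $\delta>0$ and every implied constant $c>0$ there is $p_0=p_0(c,\delta)$ such that for all $n\ge1$, $\theta\in(0,1)$ and $p\ge p_0$ with $p\ge c\,\theta n^2\ln n/\delta^2$, $$\mathbb P(\Delta\ge\delta)<\frac1p .$$ 3. (The same with $\delta$ allowed to vary with $p$.) For every $M>0$ and every implied constant $c>0$ there is $p_0=p_0(c,M)$ such that $\mathbb P(\Delta\ge\delta)<1/p$ holds for all $n\ge1$, $\theta\in(0,1)$, $p\ge p_0$ and $\delta>0$ with $(\ln p)^2/\sqrt p\le\delta\le M$ and $p\ge c\,\theta n^2\ln n/\delta^2$. -/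

import Mathlib

open MeasureTheory ProbabilityTheory

/-- The Bernoulli-Gaussian law `BG(θ)` on `ℝ`: the law of a product `b * g` with `b ~ Ber(θ)`
and `g ~ N(0, 1)` independent. -/
noncomputable def bernoulliGaussian (θ : unitInterval) : Measure ℝ :=
  ((bernoulliMeasure (1 : ℝ) 0 θ).prod (gaussianReal 0 1)).map (fun z => z.1 * z.2)

/-- The entries of the random `n × p` matrix `X` are independent, each with law `BG(θ)`. -/
structure IsBernoulliGaussianMatrix {Ω : Type*} [MeasurableSpace Ω] (μ : Measure Ω)
    {n p : ℕ} (θ : unitInterval) (X : Ω → Matrix (Fin n) (Fin p) ℝ) : Prop where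
  hasLaw : ∀ i j, HasLaw (fun ω => X ω i j) (bernoulliGaussian θ) μ
  indep : iIndepFun (fun (ij : Fin n × Fin p) ω => X ω ij.1 ij.2) μ

/-- The fourth power of the entrywise `ℓ⁴` norm of a matrix. -/
def l4NormPow {n p : ℕ} (A : Matrix (Fin n) (Fin p) ℝ) : ℝ := ∑ i, ∑ j, A i j ^ 4

/-- `sup_{W ∈ O(n)} (1/(np)) |‖W X‖₄⁴ - E ‖W X‖₄⁴|` at the sample point `ω`. -/
noncomputable def supDeviation {Ω : Type*} [MeasurableSpace Ω] (μ : Measure Ω)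
    {n p : ℕ} (X : Ω → Matrix (Fin n) (Fin p) ℝ) (ω : Ω) : ℝ :=
  ⨆ W : Matrix.orthogonalGroup (Fin n) ℝ,
    1 / ((n : ℝ) * p) *
      |l4NormPow ((W : Matrix (Fin n) (Fin n) ℝ) * X ω)
        - ∫ ω', l4NormPow ((W : Matrix (Fin n) (Fin n) ℝ) * X ω') ∂μ|

theorem bernoulliGaussian_eq (θ : unitInterval) :
    bernoulliGaussian θ = unitInterval.toNNReal θ • gaussianReal 0 1
      + unitInterval.toNNReal (unitInterval.symm θ) • Measure.dirac 0 := by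
  have hm : Measurable (fun z : ℝ × ℝ => z.1 * z.2) := by fun_prop
  rw [bernoulliGaussian, bernoulliMeasure_def, Measure.add_prod, Measure.prod_smul_left,
    Measure.prod_smul_left, Measure.map_add _ _ hm, Measure.map_smul, Measure.map_smul,
    Measure.dirac_prod, Measure.dirac_prod, Measure.map_map hm (by fun_prop),
    Measure.map_map hm (by fun_prop)]
  have h1 : ((fun z : ℝ × ℝ => z.1 * z.2) ∘ Prod.mk 1) = id := by ext; simp
  have h0 : ((fun z : ℝ × ℝ => z.1 * z.2) ∘ Prod.mk 0) = fun _ => 0 := by ext; simp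
  rw [h1, h0, Measure.map_id, Measure.map_const]
  simp

instance isProbabilityMeasure_bernoulliGaussian (θ : unitInterval) :
    IsProbabilityMeasure (bernoulliGaussian θ) := by
  unfold bernoulliGaussian
  exact Measure.isProbabilityMeasure_map (by fun_prop)

theorem integrable_bernoulliGaussian {θ : unitInterval} {f : ℝ → ℝ}
    (hf : Integrable f (gaussianReal 0 1)) : Integrable f (bernoulliGaussian θ) := by
  rw [bernoulliGaussian_eq]
  exact (hf.smul_measure_nnreal).add_measure
    ((integrable_dirac (by simp)).smul_measure_nnreal)

theorem integral_bernoulliGaussian {θ : unitInterval} {f : ℝ → ℝ}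
    (hf : Integrable f (gaussianReal 0 1)) :
    ∫ x, f x ∂(bernoulliGaussian θ) = θ * ∫ x, f x ∂(gaussianReal 0 1) + (1 - θ) * f 0 := by
  rw [bernoulliGaussian_eq, integral_add_measure hf.smul_measure_nnreal
    ((integrable_dirac (by simp)).smul_measure_nnreal), integral_smul_nnreal_measure,
    integral_smul_nnreal_measure, integral_dirac]
  simp [NNReal.smul_def]

theorem integral_exp_mul_bernoulliGaussian (θ : unitInterval) (t : ℝ) :
    ∫ x, Real.exp (t * x) ∂(bernoulliGaussian θ) = 1 + θ * (Real.exp (t ^ 2 / 2) - 1) := by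
  rw [integral_bernoulliGaussian (integrable_exp_mul_gaussianReal t)]
  have := congrFun (mgf_fun_id_gaussianReal (μ := 0) (v := 1)) t
  simp only [mgf] at this
  rw [this]
  simp
  ring

theorem integrable_sq_gaussianReal : Integrable (fun x : ℝ => x ^ 2) (gaussianReal 0 1) :=
  (memLp_id_gaussianReal (μ := 0) (v := 1) 2).integrable_sq

theorem integral_sq_bernoulliGaussian (θ : unitInterval) :
    ∫ x, x ^ 2 ∂(bernoulliGaussian θ) = θ := by
  rw [integral_bernoulliGaussian integrable_sq_gaussianReal]
  have h := variance_id_gaussianReal (μ := 0) (v := 1)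
  rw [variance_of_integral_eq_zero (by fun_prop) (by simp)] at h
  simp at h
  simp [h]

theorem integral_id_bernoulliGaussian (θ : unitInterval) :
    ∫ x, x ∂(bernoulliGaussian θ) = 0 := by
  rw [integral_bernoulliGaussian (f := fun x => x)
    ((memLp_id_gaussianReal (μ := 0) (v := 1) 1).integrable (by simp))]
  simp

theorem memLp_two_id_bernoulliGaussian (θ : unitInterval) :
    MemLp (fun x : ℝ => x) 2 (bernoulliGaussian θ) :=
  (memLp_two_iff_integrable_sq (by fun_prop)).2
    (integrable_bernoulliGaussian integrable_sq_gaussianReal)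

theorem integrable_exp_quarter_sq_gaussianReal :
    Integrable (fun x : ℝ => Real.exp (x ^ 2 / 4)) (gaussianReal 0 1) := by
  rw [gaussianReal_of_var_ne_zero 0 one_ne_zero, gaussianPDF_def,
    integrable_withDensity_iff_integrable_smul' (by fun_prop) (by simp)]
  have := (integrable_exp_neg_mul_sq (b := 1 / 4) (by norm_num)).const_mul (√(2 * Real.pi))⁻¹
  refine this.congr (Filter.Eventually.of_forall fun x => ?_)
  simp only [gaussianPDFReal, NNReal.coe_one, mul_one, sub_zero, smul_eq_mul]
  rw [ENNReal.toReal_ofReal (by positivity), mul_assoc, ← Real.exp_add]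
  ring_nf

theorem integral_exp_quarter_sq_gaussianReal_le :
    ∫ x, Real.exp (x ^ 2 / 4) ∂(gaussianReal 0 1) ≤ 3 / 2 := by
  rw [integral_gaussianReal_eq_integral_smul one_ne_zero]
  have : ∀ x : ℝ, gaussianPDFReal 0 1 x • Real.exp (x ^ 2 / 4)
      = (√(2 * Real.pi))⁻¹ * Real.exp (-(1 / 4) * x ^ 2) := by
    intro x
    simp only [gaussianPDFReal, NNReal.coe_one, mul_one, sub_zero, smul_eq_mul]
    rw [mul_assoc, ← Real.exp_add]
    ring_nf
  simp_rw [this]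
  rw [integral_const_mul, integral_gaussian]
  have hπ := Real.pi_pos
  have : Real.pi / (1 / 4) = 2 * (2 * Real.pi) := by ring
  rw [this, Real.sqrt_mul (by norm_num) (2 * Real.pi), mul_comm √2,
    inv_mul_cancel_left₀ (by positivity)]
  rw [Real.sqrt_le_left (by norm_num)]
  norm_num

theorem integral_exp_quarter_sq_bernoulliGaussian_le (θ : unitInterval) :
    ∫ x, Real.exp (x ^ 2 / 4) ∂(bernoulliGaussian θ) ≤ Real.exp (θ / 2) := by
  rw [integral_bernoulliGaussian integrable_exp_quarter_sq_gaussianReal]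
  have h1 := integral_exp_quarter_sq_gaussianReal_le
  have h2 := Real.add_one_le_exp ((θ : ℝ) / 2)
  have h3 : (0 : ℝ) ≤ θ := θ.2.1
  simp
  nlinarith

theorem gaussianReal_abs_gt_le {L : ℝ} (hL : 0 ≤ L) :
    (gaussianReal 0 1).real {x | L < |x|} ≤ 2 * Real.exp (-(L ^ 2 / 2)) := by
  have key : ∀ s : ℝ, s ^ 2 = 1 →
      (gaussianReal 0 1).real {x | L ≤ s * x} ≤ Real.exp (-(L ^ 2 / 2)) := by
    intro s hs
    have h := measure_ge_le_exp_mul_mgf (μ := gaussianReal 0 1) (X := fun x => s * x) (t := L) L hL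
      (by
        have := integrable_exp_mul_gaussianReal (μ := 0) (v := 1) (L * s)
        simpa [mul_assoc] using this)
    refine h.trans (le_of_eq ?_)
    rw [mgf_const_mul, mgf_fun_id_gaussianReal, ← Real.exp_add]
    congr 1
    simp only [NNReal.coe_one]
    linear_combination (L ^ 2 / 2) * hs
  have h1 := key 1 (by norm_num)
  have h2 := key (-1) (by norm_num)
  have hsub : {x : ℝ | L < |x|} ⊆ {x | L ≤ 1 * x} ∪ {x | L ≤ (-1) * x} := by
    intro x hx
    rw [Set.mem_ofPred_eq] at hx
    rcases lt_abs.1 hx with h | h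
    · left; simpa using h.le
    · right; simpa using h.le
  have := (measureReal_mono (μ := gaussianReal 0 1) hsub).trans (measureReal_union_le _ _)
  linarith

theorem bernoulliGaussian_abs_gt_le (θ : unitInterval) {L : ℝ} (hL : 0 ≤ L) :
    (bernoulliGaussian θ).real {x | L < |x|} ≤ 2 * θ * Real.exp (-(L ^ 2 / 2)) := by
  have hm : MeasurableSet {x : ℝ | L < |x|} :=
    measurableSet_lt measurable_const (by fun_prop)
  have h1 := integral_bernoulliGaussian (θ := θ)
    (integrable_const (μ := gaussianReal 0 1) (1 : ℝ) |>.indicator hm)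
  rw [integral_indicator hm, integral_indicator hm] at h1
  simp only [integral_const, smul_eq_mul, mul_one, measureReal_restrict_apply_univ] at h1
  rw [h1, Set.indicator_of_notMem (by simpa using hL)]
  have h2 := gaussianReal_abs_gt_le hL
  have h3 : (0 : ℝ) ≤ θ := θ.2.1
  nlinarith

/-- The law on `ℝⁿ` of a vector with independent Bernoulli-Gaussian coordinates. -/
noncomputable def columnLaw (n : ℕ) (θ : unitInterval) : Measure (EuclideanSpace ℝ (Fin n)) :=
  (Measure.pi fun _ => bernoulliGaussian θ).map (WithLp.toLp 2)

section ColumnLaw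

variable {n : ℕ} {θ : unitInterval}

instance isProbabilityMeasure_columnLaw : IsProbabilityMeasure (columnLaw n θ) := by
  unfold columnLaw
  exact Measure.isProbabilityMeasure_map (WithLp.measurable_toLp _ _).aemeasurable

theorem integral_columnLaw (f : EuclideanSpace ℝ (Fin n) → ℝ) :
    ∫ x, f x ∂(columnLaw n θ)
      = ∫ x, f (WithLp.toLp 2 x) ∂(Measure.pi fun _ => bernoulliGaussian θ) :=
  integral_map_equiv (MeasurableEquiv.toLp 2 (Fin n → ℝ)) f

theorem integrable_columnLaw_iff (f : EuclideanSpace ℝ (Fin n) → ℝ) :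
    Integrable f (columnLaw n θ) ↔
      Integrable (fun x => f (WithLp.toLp 2 x)) (Measure.pi fun _ => bernoulliGaussian θ) :=
  integrable_map_equiv (MeasurableEquiv.toLp 2 (Fin n → ℝ)) f

theorem real_inner_eq_sum (w x : EuclideanSpace ℝ (Fin n)) :
    inner ℝ w x = ∑ i, w i * x i := by
  simp [PiLp.inner_apply, mul_comm]

theorem exp_inner_eq_prod (w : EuclideanSpace ℝ (Fin n)) (x : Fin n → ℝ) :
    Real.exp (inner ℝ w (WithLp.toLp 2 x)) = ∏ i, Real.exp (w i * x i) := by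
  rw [real_inner_eq_sum, Real.exp_sum]

theorem integrable_exp_inner (w : EuclideanSpace ℝ (Fin n)) :
    Integrable (fun x => Real.exp (inner ℝ w x)) (columnLaw n θ) := by
  rw [integrable_columnLaw_iff]
  simp_rw [exp_inner_eq_prod]
  exact Integrable.fintype_prod (f := fun i x => Real.exp (w i * x)) fun i =>
    integrable_bernoulliGaussian (integrable_exp_mul_gaussianReal (w i))

theorem integral_exp_inner (w : EuclideanSpace ℝ (Fin n)) :
    ∫ x, Real.exp (inner ℝ w x) ∂(columnLaw n θ)
      = ∏ i, (1 + θ * (Real.exp (w i ^ 2 / 2) - 1)) := by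
  rw [integral_columnLaw]
  simp_rw [exp_inner_eq_prod]
  rw [integral_fintype_prod_eq_prod (f := fun i x => Real.exp (w i * x))]
  simp_rw [integral_exp_mul_bernoulliGaussian]

theorem prod_one_add_mul_le {ι : Type*} (s : Finset ι) (a : ι → ℝ) (ha : ∀ i, 0 ≤ a i) {t : ℝ}
    (h0 : 0 ≤ t) (h1 : t ≤ 1) :
    ∏ i ∈ s, (1 + t * a i) ≤ 1 + t * (∏ i ∈ s, (1 + a i) - 1) := by
  classical
  induction s using Finset.induction_on with
  | empty => simp
  | insert i s hi ih =>
    rw [Finset.prod_insert hi, Finset.prod_insert hi]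
    have hP : 1 ≤ ∏ i ∈ s, (1 + a i) := by
      calc (1 : ℝ) = ∏ i ∈ s, (1 : ℝ) := by simp
        _ ≤ _ := Finset.prod_le_prod (by simp) fun i _ => by linarith [ha i]
    have := mul_le_mul_of_nonneg_left ih (show 0 ≤ 1 + t * a i by have := ha i; positivity)
    have h2 : 0 ≤ t * (1 - t) * a i * (∏ i ∈ s, (1 + a i) - 1) := by
      have := ha i
      have : 0 ≤ 1 - t := by linarith
      have : 0 ≤ ∏ i ∈ s, (1 + a i) - 1 := by linarith
      positivity
    nlinarith

/-- The moment generating function of a linear form is dominated by that of a single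
Bernoulli-Gaussian variable. -/
theorem integral_exp_inner_le (w : EuclideanSpace ℝ (Fin n)) :
    ∫ x, Real.exp (inner ℝ w x) ∂(columnLaw n θ) ≤ 1 + θ * (Real.exp (‖w‖ ^ 2 / 2) - 1) := by
  rw [integral_exp_inner]
  refine (prod_one_add_mul_le _ _ (fun i => ?_) θ.2.1 θ.2.2).trans (le_of_eq ?_)
  · have := Real.add_one_le_exp (w i ^ 2 / 2)
    have := sq_nonneg (w i)
    linarith
  · simp_rw [add_sub_cancel]
    rw [← Real.exp_sum, ← Finset.sum_div, EuclideanSpace.norm_sq_eq]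
    simp

theorem integral_exp_inner_le_exp (w : EuclideanSpace ℝ (Fin n)) :
    ∫ x, Real.exp (inner ℝ w x) ∂(columnLaw n θ) ≤ Real.exp (‖w‖ ^ 2 / 2) := by
  refine (integral_exp_inner_le w).trans ?_
  have h0 := θ.2.1
  have h1 := θ.2.2
  have := Real.add_one_le_exp (‖w‖ ^ 2 / 2)
  have := sq_nonneg ‖w‖
  nlinarith

theorem integral_inner_sq (w : EuclideanSpace ℝ (Fin n)) :
    ∫ x, (inner ℝ w x) ^ 2 ∂(columnLaw n θ) = θ * ‖w‖ ^ 2 := by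
  rw [integral_columnLaw]
  have hL : ∀ i, MemLp (fun x : ℝ => w i * x) 2 (bernoulliGaussian θ) := fun i =>
    (memLp_two_id_bernoulliGaussian θ).const_mul (w i)
  have hv := variance_sum_pi (μ := fun _ : Fin n => bernoulliGaussian θ)
    (X := fun i x => w i * x) hL
  have hmean : ∀ i, ∫ x, w i * x ∂(bernoulliGaussian θ) = 0 := fun i => by
    rw [integral_const_mul, integral_id_bernoulliGaussian, mul_zero]
  have hint : ∀ i, Integrable (fun x : Fin n → ℝ => w i * x i)
      (Measure.pi fun _ => bernoulliGaussian θ) := fun i =>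
    (measurePreserving_eval (fun _ : Fin n => bernoulliGaussian θ) i).integrable_comp_of_integrable
      ((hL i).integrable (by norm_num))
  rw [variance_of_integral_eq_zero] at hv
  · simp_rw [Finset.sum_apply] at hv
    simp_rw [real_inner_eq_sum]
    rw [hv]
    have : ∀ i, Var[fun x => w i * x; bernoulliGaussian θ] = θ * w i ^ 2 := fun i => by
      rw [variance_of_integral_eq_zero (by fun_prop) (hmean i)]
      simp_rw [mul_pow]
      rw [integral_const_mul, integral_sq_bernoulliGaussian, mul_comm]
    simp_rw [this]
    rw [← Finset.mul_sum, EuclideanSpace.norm_sq_eq]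
    simp
  · exact (Finset.aemeasurable_sum _ fun i _ => (hint i).aemeasurable)
  · simp_rw [Finset.sum_apply]
    rw [integral_finsetSum _ fun i _ => hint i]
    refine Finset.sum_eq_zero fun i _ => ?_
    have hmp := measurePreserving_eval (fun _ : Fin n => bernoulliGaussian θ) i
    have := integral_map (f := fun x => w i * x) hmp.measurable.aemeasurable
      (by rw [hmp.map_eq]; fun_prop)
    rw [hmp.map_eq, hmean i] at this
    exact this.symm

theorem integrable_exp_quarter_norm_sq :
    Integrable (fun x => Real.exp (‖x‖ ^ 2 / 4)) (columnLaw n θ) := by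
  rw [integrable_columnLaw_iff]
  simp_rw [EuclideanSpace.norm_sq_eq, Real.norm_eq_abs, sq_abs, Finset.sum_div, Real.exp_sum]
  exact Integrable.fintype_prod (f := fun i x => Real.exp (x ^ 2 / 4)) fun i =>
    integrable_bernoulliGaussian integrable_exp_quarter_sq_gaussianReal

theorem integral_exp_quarter_norm_sq_le :
    ∫ x, Real.exp (‖x‖ ^ 2 / 4) ∂(columnLaw n θ) ≤ Real.exp (n * θ / 2) := by
  rw [integral_columnLaw]
  simp_rw [EuclideanSpace.norm_sq_eq, Real.norm_eq_abs, sq_abs, Finset.sum_div, Real.exp_sum]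
  rw [integral_fintype_prod_eq_prod (f := fun i x => Real.exp (x ^ 2 / 4))]
  rw [Finset.prod_const, Finset.card_univ, Fintype.card_fin, mul_div_assoc, Real.exp_nat_mul]
  exact pow_le_pow_left₀ (integral_nonneg fun x => (Real.exp_pos _).le)
    (integral_exp_quarter_sq_bernoulliGaussian_le θ) n

theorem columnLaw_coord_abs_gt_le (i : Fin n) {L : ℝ} (hL : 0 ≤ L) :
    (columnLaw n θ).real {x | L < |x i|} ≤ 2 * θ * Real.exp (-(L ^ 2 / 2)) := by
  refine le_trans (le_of_eq ?_) (bernoulliGaussian_abs_gt_le θ hL)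
  have hm : MeasurableSet {x : ℝ | L < |x|} :=
    measurableSet_lt measurable_const (by fun_prop)
  rw [← (measurePreserving_eval (fun _ : Fin n => bernoulliGaussian θ) i).measureReal_preimage
    hm.nullMeasurableSet, columnLaw, map_measureReal_apply (WithLp.measurable_toLp _ _)
    (measurableSet_lt measurable_const (by fun_prop))]
  rfl

end ColumnLaw

section ScalarInequalities

theorem pow_eight_le_cosh (y : ℝ) : y ^ 8 ≤ 40320 * (Real.cosh y - 1) := by
  have h := sum_le_hasSum (Finset.range 5) (fun n _ => by
    have : 0 ≤ y ^ (2 * n) := (even_two_mul n).pow_nonneg y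
    positivity) (Real.hasSum_cosh y)
  simp only [Finset.sum_range_succ, Finset.sum_range_zero] at h
  norm_num [Nat.factorial] at h
  have h2 := sq_nonneg y
  have h4 := sq_nonneg (y ^ 2)
  have h6 := sq_nonneg (y ^ 3)
  nlinarith

theorem pow_four_le_cosh (y : ℝ) : y ^ 4 ≤ 24 * (Real.cosh y - 1 - y ^ 2 / 2) := by
  have h := sum_le_hasSum (Finset.range 3) (fun n _ => by
    have : 0 ≤ y ^ (2 * n) := (even_two_mul n).pow_nonneg y
    positivity) (Real.hasSum_cosh y)
  simp only [Finset.sum_range_succ, Finset.sum_range_zero] at h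
  norm_num [Nat.factorial] at h
  linarith

theorem pow_four_le_exp_abs (y : ℝ) : y ^ 4 ≤ 24 * Real.exp |y| := by
  have h := Real.pow_div_factorial_le_exp |y| (abs_nonneg y) 4
  rw [div_le_iff₀ (by positivity), Even.pow_abs (by decide)] at h
  norm_num [Nat.factorial] at h
  linarith

theorem exp_abs_le_exp_add_exp_neg (y : ℝ) : Real.exp |y| ≤ Real.exp y + Real.exp (-y) := by
  rcases abs_cases y with h | h <;> rw [h.1]
  · linarith [Real.exp_pos (-y)]
  · linarith [Real.exp_pos y]

theorem exp_one_eighth_le : Real.exp (1 / 8) ≤ 1 + 1 / 8 + 1 / 120 := by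
  have := Real.exp_bound' (x := 1 / 8) (by norm_num) (by norm_num) (n := 4) (by norm_num)
  refine this.trans ?_
  simp only [Finset.sum_range_succ, Finset.sum_range_zero]
  norm_num [Nat.factorial]

theorem exp_half_le : Real.exp (1 / 2) ≤ 2 := by
  have := Real.exp_bound' (x := 1 / 2) (by norm_num) (by norm_num) (n := 4) (by norm_num)
  refine this.trans ?_
  simp only [Finset.sum_range_succ, Finset.sum_range_zero]
  norm_num [Nat.factorial]

theorem exp_nine_halves_le : Real.exp (9 / 2) ≤ 100 := by
  have h : Real.exp (9 / 2) ^ 2 = Real.exp 1 ^ 9 := by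
    rw [← Real.exp_nat_mul, ← Real.exp_nat_mul]; norm_num
  have h1 : Real.exp 1 ^ 9 ≤ 2.7182818286 ^ 9 :=
    pow_le_pow_left₀ (Real.exp_pos _).le Real.exp_one_lt_d9.le 9
  have : Real.exp (9 / 2) ^ 2 ≤ 100 ^ 2 := by rw [h]; exact h1.trans (by norm_num)
  exact (pow_le_pow_iff_left₀ (Real.exp_pos _).le (by norm_num) (by norm_num)).1 this

/-- The excess of `y ^ 4` over the level `B ^ 4`, bounded by exponentials. -/
theorem pow_four_sub_min_le (y : ℝ) {B : ℝ} (hB : 0 ≤ B) :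
    y ^ 4 - min (y ^ 4) (B ^ 4)
      ≤ 24 * Real.exp (-(2 * B)) * (Real.exp (3 * y) + Real.exp (-(3 * y))) := by
  rcases le_total (y ^ 4) (B ^ 4) with h | h
  · rw [min_eq_left h, sub_self]; positivity
  · rw [min_eq_right h]
    have hy : B ≤ |y| := by
      rw [← Even.pow_abs (by decide : Even 4) y] at h
      exact (pow_le_pow_iff_left₀ hB (abs_nonneg y) (by norm_num)).1 h
    have h1 := pow_four_le_exp_abs y
    have h2 : Real.exp |y| ≤ Real.exp (-(2 * B)) * Real.exp |3 * y| := by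
      rw [← Real.exp_add, abs_mul]
      refine Real.exp_le_exp.2 ?_
      norm_num
      linarith
    have h3 := mul_le_mul_of_nonneg_left (exp_abs_le_exp_add_exp_neg (3 * y))
      (Real.exp_pos (-(2 * B))).le
    have : 0 ≤ B ^ 4 := by positivity
    linarith

theorem exp_eighth_sq_excess_le (y : ℝ) {a : ℝ} (ha : 0 ≤ a) :
    Real.exp (max (|y| - a) 0 ^ 2 / 8)
      ≤ 1 + Real.exp (-(a ^ 2 / 8)) * Real.exp (y ^ 2 / 4) := by
  rcases le_total |y| a with h | h
  · rw [max_eq_right (by linarith)]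
    have : 0 ≤ Real.exp (-(a ^ 2 / 8)) * Real.exp (y ^ 2 / 4) := by positivity
    simpa using this
  · rw [max_eq_left (by linarith), ← Real.exp_add]
    have : (|y| - a) ^ 2 / 8 ≤ -(a ^ 2 / 8) + y ^ 2 / 4 := by
      rw [← sq_abs y]; nlinarith
    linarith [Real.exp_le_exp.2 this]

end ScalarInequalities

section Moments

variable {n : ℕ} {θ : unitInterval} {w : EuclideanSpace ℝ (Fin n)}

theorem integrable_exp_mul_inner (w : EuclideanSpace ℝ (Fin n)) (c : ℝ) :
    Integrable (fun x => Real.exp (c * inner ℝ w x)) (columnLaw n θ) := by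
  simpa [real_inner_smul_left] using integrable_exp_inner (θ := θ) (c • w)

theorem integral_exp_mul_inner_le (w : EuclideanSpace ℝ (Fin n)) (c : ℝ) :
    ∫ x, Real.exp (c * inner ℝ w x) ∂(columnLaw n θ)
      ≤ 1 + θ * (Real.exp (c ^ 2 * ‖w‖ ^ 2 / 2) - 1) := by
  simpa [real_inner_smul_left, norm_smul, mul_pow] using integral_exp_inner_le (θ := θ) (c • w)

theorem integrable_cosh_mul_inner (w : EuclideanSpace ℝ (Fin n)) (c : ℝ) :
    Integrable (fun x => Real.cosh (c * inner ℝ w x)) (columnLaw n θ) := by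
  simp_rw [Real.cosh_eq, ← neg_mul]
  exact ((integrable_exp_mul_inner w c).add (integrable_exp_mul_inner w (-c))).div_const 2

theorem integral_cosh_mul_inner_le (w : EuclideanSpace ℝ (Fin n)) (c : ℝ) :
    ∫ x, Real.cosh (c * inner ℝ w x) ∂(columnLaw n θ)
      ≤ 1 + θ * (Real.exp (c ^ 2 * ‖w‖ ^ 2 / 2) - 1) := by
  simp_rw [Real.cosh_eq, ← neg_mul]
  rw [integral_div, integral_add (integrable_exp_mul_inner w c) (integrable_exp_mul_inner w (-c))]
  have h1 := integral_exp_mul_inner_le (θ := θ) w c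
  have h2 := integral_exp_mul_inner_le (θ := θ) w (-c)
  rw [neg_sq] at h2
  linarith

theorem integrable_inner_pow (w : EuclideanSpace ℝ (Fin n)) (k : ℕ) :
    Integrable (fun x => (inner ℝ w x) ^ k) (columnLaw n θ) := by
  have h := (((integrable_exp_mul_inner (θ := θ) w 1).add
    (integrable_exp_mul_inner w (-1))).const_mul (k.factorial : ℝ))
  refine h.mono' (by fun_prop) (Filter.Eventually.of_forall fun x => ?_)
  have h1 := Real.pow_div_factorial_le_exp |inner ℝ w x| (abs_nonneg _) k
  have h2 := exp_abs_le_exp_add_exp_neg (inner ℝ w x)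
  rw [div_le_iff₀ (by positivity)] at h1
  simp only [Real.norm_eq_abs, abs_pow, Pi.add_apply, one_mul, neg_one_mul]
  calc _ ≤ _ := h1
    _ ≤ _ := by rw [mul_comm]; gcongr

theorem integral_inner_pow_four_le (hw : ‖w‖ = 1) :
    ∫ x, (inner ℝ w x) ^ 4 ∂(columnLaw n θ) ≤ 16 / 5 * θ := by
  have hle : ∀ x : EuclideanSpace ℝ (Fin n), (inner ℝ w x) ^ 4
      ≤ 384 * (Real.cosh (1 / 2 * inner ℝ w x) - 1) - 48 * (inner ℝ w x) ^ 2 := fun x => by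
    have := pow_four_le_cosh (1 / 2 * inner ℝ w x)
    ring_nf at this ⊢
    linarith
  have hc := integrable_cosh_mul_inner (θ := θ) w (1 / 2)
  have hc' : Integrable (fun x => 384 * (Real.cosh (1 / 2 * inner ℝ w x) - 1)) (columnLaw n θ) :=
    (hc.sub (integrable_const 1)).const_mul 384
  have hs := (integrable_inner_pow (θ := θ) w 2).const_mul 48
  have h1 := integral_mono (integrable_inner_pow (θ := θ) w 4) (hc'.sub hs) hle
  simp only [Pi.sub_apply] at h1
  rw [integral_sub hc' hs, integral_const_mul, integral_const_mul,
    integral_sub hc (integrable_const 1), integral_inner_sq] at h1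
  have h2 := integral_cosh_mul_inner_le (θ := θ) w (1 / 2)
  rw [hw] at h1 h2
  have h3 := exp_one_eighth_le
  have h4 := θ.2.1
  norm_num at h1 h2 h3
  nlinarith

theorem integral_inner_pow_eight_le (hw : ‖w‖ ≤ 1) :
    ∫ x, (inner ℝ w x) ^ 8 ∂(columnLaw n θ) ≤ 40320 * θ := by
  have hc := integrable_cosh_mul_inner (θ := θ) w 1
  have h1 := integral_mono (integrable_inner_pow (θ := θ) w 8)
    ((hc.sub (integrable_const 1)).const_mul 40320) fun x => by
      simpa using pow_eight_le_cosh (inner ℝ w x)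
  simp only [Pi.sub_apply] at h1
  rw [integral_const_mul, integral_sub hc (integrable_const 1)] at h1
  have h2 := integral_cosh_mul_inner_le (θ := θ) w 1
  have h3 : Real.exp (1 ^ 2 * ‖w‖ ^ 2 / 2) ≤ 2 := by
    refine (Real.exp_le_exp.2 ?_).trans exp_half_le
    have := norm_nonneg w
    nlinarith
  have h4 := θ.2.1
  simp only [integral_const, probReal_univ, smul_eq_mul] at h1
  nlinarith

theorem integral_pow_four_excess_le (hw : ‖w‖ ≤ 1) {B : ℝ} (hB : 0 ≤ B) :
    ∫ x, ((inner ℝ w x) ^ 4 - min ((inner ℝ w x) ^ 4) (B ^ 4)) ∂(columnLaw n θ)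
      ≤ 4800 * Real.exp (-(2 * B)) := by
  have hi := ((integrable_exp_mul_inner (θ := θ) w 3).add
    (integrable_exp_mul_inner w (-3))).const_mul (24 * Real.exp (-(2 * B)))
  have h1 := integral_mono_of_nonneg (μ := columnLaw n θ)
    (f := fun x => (inner ℝ w x) ^ 4 - min ((inner ℝ w x) ^ 4) (B ^ 4))
    (Filter.Eventually.of_forall fun x => sub_nonneg.2 (min_le_left _ _)) hi
    (Filter.Eventually.of_forall fun x => by
      simpa only [Pi.add_apply, neg_mul] using pow_four_sub_min_le (inner ℝ w x) hB)
  refine h1.trans ?_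
  rw [integral_const_mul]
  have h3 : ∀ c : ℝ, c ^ 2 = 9 → ∫ x, Real.exp (c * inner ℝ w x) ∂(columnLaw n θ) ≤ 100 := by
    intro c hc
    have := integral_exp_inner_le_exp (θ := θ) (c • w)
    simp only [real_inner_smul_left, norm_smul, mul_pow, Real.norm_eq_abs, sq_abs] at this
    refine this.trans ((Real.exp_le_exp.2 ?_).trans exp_nine_halves_le)
    have := norm_nonneg w
    rw [hc]
    nlinarith
  have := h3 3 (by norm_num)
  have := h3 (-3) (by norm_num)
  simp only [Pi.add_apply]
  rw [integral_add (integrable_exp_mul_inner w 3) (integrable_exp_mul_inner w (-3))]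
  have := Real.exp_pos (-(2 * B))
  nlinarith

theorem integral_exp_mul_gaussianReal (c : ℝ) :
    ∫ g, Real.exp (c * g) ∂(gaussianReal 0 1) = Real.exp (c ^ 2 / 2) := by
  have := congrFun (mgf_fun_id_gaussianReal (μ := 0) (v := 1)) c
  simp only [mgf] at this
  rw [this]
  simp

theorem integrable_prod_exp_mul_inner (hw : ‖w‖ ≤ 1) :
    Integrable (fun z : ℝ × EuclideanSpace ℝ (Fin n) => Real.exp (z.1 / √2 * inner ℝ w z.2))
      ((gaussianReal 0 1).prod (columnLaw n θ)) := by
  have hmeas : AEStronglyMeasurable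
      (fun z : ℝ × EuclideanSpace ℝ (Fin n) => Real.exp (z.1 / √2 * inner ℝ w z.2))
      ((gaussianReal 0 1).prod (columnLaw n θ)) := by fun_prop
  rw [integrable_prod_iff hmeas]
  refine ⟨Filter.Eventually.of_forall fun g => integrable_exp_mul_inner w (g / √2),
    integrable_exp_quarter_sq_gaussianReal.mono' hmeas.norm.integral_prod_right'
      (Filter.Eventually.of_forall fun g => ?_)⟩
  simp only [Real.norm_eq_abs, Real.abs_exp]
  rw [abs_of_nonneg (integral_nonneg fun x => (Real.exp_pos _).le)]
  have := integral_exp_inner_le_exp (θ := θ) ((g / √2) • w)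
  simp only [real_inner_smul_left, norm_smul, mul_pow, Real.norm_eq_abs, sq_abs, div_pow] at this
  refine this.trans (Real.exp_le_exp.2 ?_)
  rw [Real.sq_sqrt (by norm_num)]
  have := norm_nonneg w
  have : ‖w‖ ^ 2 ≤ 1 := by nlinarith
  have := mul_le_mul_of_nonneg_left this (sq_nonneg g)
  linarith

theorem exp_quarter_sq_eq_integral (y : ℝ) :
    Real.exp (y ^ 2 / 4) = ∫ g, Real.exp (g / √2 * y) ∂(gaussianReal 0 1) := by
  have : ∀ g : ℝ, g / √2 * y = (y / √2) * g := fun g => by ring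
  simp_rw [this]
  rw [integral_exp_mul_gaussianReal, div_pow, Real.sq_sqrt (by norm_num)]
  ring_nf

theorem integrable_exp_quarter_inner_sq (hw : ‖w‖ ≤ 1) :
    Integrable (fun x => Real.exp ((inner ℝ w x) ^ 2 / 4)) (columnLaw n θ) := by
  simp_rw [exp_quarter_sq_eq_integral]
  exact (integrable_prod_exp_mul_inner hw).integral_prod_right

theorem integral_exp_quarter_inner_sq_le (hw : ‖w‖ ≤ 1) :
    ∫ x, Real.exp ((inner ℝ w x) ^ 2 / 4) ∂(columnLaw n θ) ≤ 3 / 2 := by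
  simp_rw [exp_quarter_sq_eq_integral]
  rw [integral_integral_swap (f := fun x g => Real.exp (g / √2 * inner ℝ w x))
    (integrable_prod_exp_mul_inner hw).swap]
  refine le_trans (integral_mono (integrable_prod_exp_mul_inner hw).integral_prod_left
    integrable_exp_quarter_sq_gaussianReal fun g => ?_) integral_exp_quarter_sq_gaussianReal_le
  have := integral_exp_inner_le_exp (θ := θ) ((g / √2) • w)
  simp only [real_inner_smul_left, norm_smul, mul_pow, Real.norm_eq_abs, sq_abs, div_pow] at this
  refine this.trans (Real.exp_le_exp.2 ?_)
  rw [Real.sq_sqrt (by norm_num)]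
  have := norm_nonneg w
  have : ‖w‖ ^ 2 ≤ 1 := by nlinarith
  have := mul_le_mul_of_nonneg_left this (sq_nonneg g)
  linarith

theorem integrable_exp_eighth_sq_excess (hw : ‖w‖ ≤ 1) {a : ℝ} (ha : 0 ≤ a) :
    Integrable (fun x => Real.exp (max (|inner ℝ w x| - a) 0 ^ 2 / 8)) (columnLaw n θ) := by
  refine ((integrable_const 1).add ((integrable_exp_quarter_inner_sq hw).const_mul
    (Real.exp (-(a ^ 2 / 8))))).mono' (by fun_prop) (Filter.Eventually.of_forall fun x => ?_)
  rw [Real.norm_eq_abs, Real.abs_exp]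
  exact exp_eighth_sq_excess_le _ ha

theorem integral_exp_eighth_sq_excess_le (hw : ‖w‖ ≤ 1) {a : ℝ} (ha : 0 ≤ a) :
    ∫ x, Real.exp (max (|inner ℝ w x| - a) 0 ^ 2 / 8) ∂(columnLaw n θ)
      ≤ Real.exp (3 / 2 * Real.exp (-(a ^ 2 / 8))) := by
  have h := integral_mono (integrable_exp_eighth_sq_excess (θ := θ) hw ha)
    ((integrable_const 1).add ((integrable_exp_quarter_inner_sq hw).const_mul
    (Real.exp (-(a ^ 2 / 8))))) fun x => exp_eighth_sq_excess_le _ ha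
  refine h.trans ?_
  simp only [Pi.add_apply]
  rw [integral_add (integrable_const 1) ((integrable_exp_quarter_inner_sq hw).const_mul _),
    integral_const_mul]
  have h1 := integral_exp_quarter_inner_sq_le (θ := θ) hw
  have h2 := Real.add_one_le_exp (3 / 2 * Real.exp (-(a ^ 2 / 8)))
  have h3 := Real.exp_pos (-(a ^ 2 / 8))
  simp only [integral_const, probReal_univ, smul_eq_mul]
  nlinarith

theorem integrable_norm_sq : Integrable (fun x => ‖x‖ ^ 2) (columnLaw n θ) := by
  refine (integrable_exp_quarter_norm_sq.const_mul 4).mono' (by fun_prop)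
    (Filter.Eventually.of_forall fun x => ?_)
  rw [Real.norm_eq_abs, abs_of_nonneg (sq_nonneg _)]
  linarith [Real.add_one_le_exp (‖x‖ ^ 2 / 4)]

theorem integral_norm_sq : ∫ x, ‖x‖ ^ 2 ∂(columnLaw n θ) = n * θ := by
  have h : ∀ x : EuclideanSpace ℝ (Fin n),
      ‖x‖ ^ 2 = ∑ i, (inner ℝ (EuclideanSpace.single i (1 : ℝ)) x) ^ 2 := fun x => by
    simp [EuclideanSpace.norm_sq_eq, EuclideanSpace.inner_single_left]
  simp_rw [h]
  rw [integral_finsetSum _ fun i _ => integrable_inner_pow _ 2]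
  simp_rw [integral_inner_sq]
  simp

theorem integrable_norm : Integrable (fun x => ‖x‖) (columnLaw n θ) := by
  refine ((integrable_const 1).add integrable_norm_sq).mono' (by fun_prop)
    (Filter.Eventually.of_forall fun x => ?_)
  simp only [norm_norm, Pi.add_apply]
  nlinarith [sq_nonneg (‖x‖ - 1), norm_nonneg x]

theorem integral_norm_le : ∫ x, ‖x‖ ∂(columnLaw n θ) ≤ 1 + n := by
  have h := integral_mono (integrable_norm (θ := θ)) ((integrable_const (1 : ℝ)).add
    (integrable_norm_sq (n := n) (θ := θ))) fun x => by
      simp only [Pi.add_apply]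
      nlinarith [sq_nonneg (‖x‖ - 1), norm_nonneg x]
  simp only [Pi.add_apply] at h
  rw [integral_add (integrable_const 1) integrable_norm_sq, integral_norm_sq] at h
  simp only [integral_const, probReal_univ, smul_eq_mul] at h
  have h1 := θ.2.1
  have h2 := θ.2.2
  have : (0 : ℝ) ≤ n := by positivity
  nlinarith

end Moments

section ProductMeasure

variable {S : Type*} [MeasurableSpace S] {ν : Measure S} [IsProbabilityMeasure ν]

theorem pi_real_exists_mem_le (p : ℕ) {A : Set S} (hA : MeasurableSet A) :
    (Measure.pi fun _ : Fin p => ν).real {x | ∃ j, x j ∈ A} ≤ p * ν.real A := by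
  have h : {x : Fin p → S | ∃ j, x j ∈ A} = ⋃ j, Function.eval j ⁻¹' A := by ext; simp
  rw [h]
  refine (measureReal_iUnion_fintype_le _).trans (le_of_eq ?_)
  simp_rw [(measurePreserving_eval (fun _ : Fin p => ν) _).measureReal_preimage
    hA.nullMeasurableSet]
  simp

/-- Chernoff's bound for a sum of i.i.d. terms. -/
theorem pi_real_sum_ge_le (p : ℕ) {f : S → ℝ} (hf : Integrable (fun s => Real.exp (f s)) ν)
    {a : ℝ} (ha : ∫ s, Real.exp (f s) ∂ν ≤ Real.exp a) (u : ℝ) :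
    (Measure.pi fun _ : Fin p => ν).real {x | u ≤ ∑ j, f (x j)} ≤ Real.exp (p * a - u) := by
  have hint := Integrable.fintype_prod (ι := Fin p) (f := fun _ s => Real.exp (f s))
    (μ := fun _ => ν) fun _ => hf
  have hmk := mul_meas_ge_le_integral_of_nonneg
    (Filter.Eventually.of_forall fun x => Finset.prod_nonneg fun j _ => (Real.exp_pos (f (x j))).le)
    hint (Real.exp u)
  rw [integral_fintype_prod_eq_prod (f := fun (_ : Fin p) s => Real.exp (f s))] at hmk
  simp_rw [← Real.exp_sum, Real.exp_le_exp] at hmk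
  rw [Finset.prod_const, Finset.card_univ, Fintype.card_fin] at hmk
  rw [Real.exp_sub, Real.exp_nat_mul, le_div_iff₀ (Real.exp_pos u), mul_comm]
  exact hmk.trans (pow_le_pow_left₀ (integral_nonneg fun s => (Real.exp_pos _).le) ha p)

theorem integral_exp_mul_sub_le {Y : S → ℝ} (hY : Measurable Y) {b v : ℝ}
    (h0 : ∀ s, 0 ≤ Y s) (hb : ∀ s, Y s ≤ b) (hv : ∫ s, Y s ^ 2 ∂ν ≤ v) {l : ℝ}
    (hl : |l| * b ≤ 1) :
    Integrable (fun s => Real.exp (l * (Y s - ∫ t, Y t ∂ν))) ν ∧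
      ∫ s, Real.exp (l * (Y s - ∫ t, Y t ∂ν)) ∂ν ≤ Real.exp (l ^ 2 * v) := by
  have hbound : ∀ {g : S → ℝ} (C : ℝ), Measurable g → (∀ s, |g s| ≤ C) → Integrable g ν :=
    fun C hg hC => Integrable.of_bound hg.aestronglyMeasurable C (Filter.Eventually.of_forall hC)
  have hYi : Integrable Y ν := hbound b hY fun s => by rw [abs_of_nonneg (h0 s)]; exact hb s
  have hY2 : Integrable (fun s => Y s ^ 2) ν := hbound (b ^ 2) (hY.pow_const 2) fun s => by
    rw [abs_of_nonneg (sq_nonneg _)]; exact pow_le_pow_left₀ (h0 s) (hb s) 2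
  set m := ∫ t, Y t ∂ν with hm
  have hm0 : 0 ≤ m := integral_nonneg h0
  have hmb : m ≤ b := by
    have := integral_mono hYi (integrable_const b) hb
    simpa using this
  have habs : ∀ s, |l * (Y s - m)| ≤ 1 := fun s => by
    rw [abs_mul]
    refine le_trans (mul_le_mul_of_nonneg_left ?_ (abs_nonneg l)) hl
    rw [abs_le]
    constructor <;> linarith [h0 s, hb s]
  have hexp : Integrable (fun s => Real.exp (l * (Y s - m))) ν :=
    hbound (Real.exp 1) (by fun_prop) fun s => by
      rw [Real.abs_exp]; exact Real.exp_le_exp.2 ((le_abs_self _).trans (habs s))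
  refine ⟨hexp, ?_⟩
  have hquad : ∀ s, Real.exp (l * (Y s - m))
      ≤ 1 + l * (Y s - m) + l ^ 2 * (Y s ^ 2 - 2 * m * Y s + m ^ 2) := fun s => by
    have := (abs_le.1 (Real.abs_exp_sub_one_sub_id_le (habs s))).2
    nlinarith
  have hi0 : Integrable (fun s => l * (Y s - m)) ν := (hYi.sub (integrable_const m)).const_mul l
  have hi1 : Integrable (fun s => 1 + l * (Y s - m)) ν := (integrable_const 1).add hi0
  have hi3 : Integrable (fun s => Y s ^ 2 - 2 * m * Y s) ν := hY2.sub (hYi.const_mul (2 * m))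
  have hi2 : Integrable (fun s => l ^ 2 * (Y s ^ 2 - 2 * m * Y s + m ^ 2)) ν :=
    (hi3.add (integrable_const _)).const_mul _
  have h := integral_mono hexp (hi1.add hi2) hquad
  simp only [Pi.add_apply] at h
  rw [integral_add hi1 hi2, integral_add (integrable_const 1) hi0,
    integral_const_mul, integral_const_mul,
    integral_sub hYi (integrable_const m), integral_add hi3 (integrable_const _),
    integral_sub hY2 (hYi.const_mul (2 * m)), integral_const_mul] at h
  simp only [integral_const, probReal_univ, smul_eq_mul, one_mul, mul_one] at h
  rw [← hm] at h
  have h2 := Real.add_one_le_exp (l ^ 2 * v)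
  have h3 : l ^ 2 * (∫ s, Y s ^ 2 ∂ν) ≤ l ^ 2 * v := mul_le_mul_of_nonneg_left hv (sq_nonneg l)
  nlinarith [mul_nonneg (sq_nonneg l) (sq_nonneg m)]

/-- Bernstein's inequality for the empirical mean of a bounded nonnegative function of i.i.d.
variables. -/
theorem pi_real_abs_mean_sub_ge_le {p : ℕ} (hp : 0 < p) {Y : S → ℝ} (hY : Measurable Y) {b v t : ℝ}
    (h0 : ∀ s, 0 ≤ Y s) (hb : ∀ s, Y s ≤ b) (hv : ∫ s, Y s ^ 2 ∂ν ≤ v) (hbpos : 0 < b)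
    (hvpos : 0 ≤ v) (ht : 0 < t) :
    (Measure.pi fun _ : Fin p => ν).real {x | t ≤ |(1 / p : ℝ) * ∑ j, Y (x j) - ∫ s, Y s ∂ν|}
      ≤ 2 * Real.exp (-(3 * p * t ^ 2 / (16 * v + 4 * b * t))) := by
  have hp' : (0 : ℝ) < p := by exact_mod_cast hp
  set m := ∫ s, Y s ∂ν with hm
  set l := t / (4 * v + b * t) with hl
  have hden : 0 < 4 * v + b * t := by positivity
  have hlpos : 0 < l := by positivity
  have hlb : l * b ≤ 1 := by
    rw [hl, div_mul_eq_mul_div, div_le_one hden]; nlinarith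
  have key : ∀ s : ℝ, |s| = 1 →
      (Measure.pi fun _ : Fin p => ν).real {x | l * (p * t) ≤ ∑ j, s * l * (Y (x j) - m)}
        ≤ Real.exp (-(3 * p * t ^ 2 / (16 * v + 4 * b * t))) := by
    intro s hs
    have hs2 : s ^ 2 = 1 := by rw [← sq_abs, hs]; norm_num
    obtain ⟨hi, hle⟩ := integral_exp_mul_sub_le (ν := ν) hY h0 hb hv (l := s * l)
      (by rw [abs_mul, hs, one_mul, abs_of_pos hlpos]; exact hlb)
    refine (pi_real_sum_ge_le p hi hle (l * (p * t))).trans (Real.exp_le_exp.2 ?_)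
    rw [mul_pow, hs2, one_mul]
    have hlv : l * (4 * v) ≤ t := by
      rw [hl, div_mul_eq_mul_div, div_le_iff₀ hden]; nlinarith [mul_pos hbpos ht]
    have : 3 * p * t ^ 2 / (16 * v + 4 * b * t) = 3 / 4 * (p * t) * l := by
      rw [hl]; field_simp; ring
    rw [this]
    have := mul_le_mul_of_nonneg_left hlv (mul_nonneg hp'.le hlpos.le)
    nlinarith
  have hsub : {x : Fin p → S | t ≤ |(1 / p : ℝ) * ∑ j, Y (x j) - m|}
      ⊆ {x | l * (p * t) ≤ ∑ j, 1 * l * (Y (x j) - m)}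
        ∪ {x | l * (p * t) ≤ ∑ j, (-1) * l * (Y (x j) - m)} := by
    intro x hx
    rw [Set.mem_ofPred_eq] at hx
    have hsum : ∀ s : ℝ, ∑ j, s * l * (Y (x j) - m)
        = l * (p * (s * ((1 / p : ℝ) * ∑ j, Y (x j) - m))) := fun s => by
      rw [← Finset.mul_sum, Finset.sum_sub_distrib]
      simp only [Finset.sum_const, Finset.card_univ, Fintype.card_fin, nsmul_eq_mul]
      field_simp
    rcases le_abs.1 hx with h | h
    · left
      rw [Set.mem_ofPred_eq, hsum]
      gcongr
      linarith
    · right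
      rw [Set.mem_ofPred_eq, hsum]
      gcongr
      linarith
  have := (measureReal_mono (μ := Measure.pi fun _ : Fin p => ν) hsub).trans
    (measureReal_union_le _ _)
  linarith [key 1 (by norm_num), key (-1) (by norm_num)]

end ProductMeasure

section Net

variable {E : Type*} [NormedAddCommGroup E] [NormedSpace ℝ E] [FiniteDimensional ℝ E]

open Module in
/-- A separated subset of the unit ball has few points, by comparison of volumes. -/
theorem card_le_of_separated_unit_ball (s : Finset E) {ε : ℝ} (hε : 0 < ε)
    (hs : ∀ c ∈ s, ‖c‖ ≤ 1) (h : ∀ c ∈ s, ∀ d ∈ s, c ≠ d → ε ≤ ‖c - d‖) :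
    (s.card : ℝ) ≤ (1 + 2 / ε) ^ finrank ℝ E := by
  borelize E
  let μ : Measure E := Measure.addHaar
  have hρ : (0 : ℝ) < 1 + ε / 2 := by positivity
  have hd : 0 < ε / 2 := by positivity
  set A := ⋃ c ∈ s, Metric.ball (c : E) (ε / 2) with hA
  have D : Set.Pairwise (s : Set E)
      (Function.onFun Disjoint fun c => Metric.ball (c : E) (ε / 2)) := by
    rintro c hc d hd hcd
    apply Metric.ball_disjoint_ball
    rw [dist_eq_norm]
    linarith [h c hc d hd hcd]
  have A_subset : A ⊆ Metric.ball (0 : E) (1 + ε / 2) := by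
    refine Set.iUnion₂_subset fun x hx => Metric.ball_subset_ball' ?_
    rw [dist_zero_right]
    linarith [hs x hx]
  have I : (s.card : ENNReal) * ENNReal.ofReal ((ε / 2) ^ finrank ℝ E) * μ (Metric.ball 0 1) ≤
      ENNReal.ofReal ((1 + ε / 2) ^ finrank ℝ E) * μ (Metric.ball 0 1) :=
    calc
      _ = μ A := by
        rw [hA, measure_biUnion_finset D fun c _ => measurableSet_ball]
        simp only [μ.addHaar_ball_of_pos _ hd]
        simp only [Finset.sum_const, nsmul_eq_mul, mul_assoc]
      _ ≤ μ (Metric.ball (0 : E) (1 + ε / 2)) := measure_mono A_subset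
      _ = _ := by simp only [μ.addHaar_ball_of_pos _ hρ]
  have J := (ENNReal.mul_le_mul_iff_left (Metric.measure_ball_pos μ (0 : E) zero_lt_one).ne'
    measure_ball_lt_top.ne).1 I
  have K := ENNReal.toReal_le_of_le_ofReal (pow_nonneg hρ.le _) J
  rw [ENNReal.toReal_mul, ENNReal.toReal_natCast, ENNReal.toReal_ofReal (by positivity),
    ← le_div_iff₀ (by positivity), ← div_pow] at K
  refine K.trans (le_of_eq ?_)
  congr 1
  field_simp
  ring

open Module in
theorem exists_finset_net (A : Set E) (hA : ∀ x ∈ A, ‖x‖ ≤ 1) {ε : ℝ} (hε : 0 < ε) :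
    ∃ s : Finset E, ↑s ⊆ A ∧ (s.card : ℝ) ≤ (1 + 2 / ε) ^ finrank ℝ E ∧
      ∀ x ∈ A, ∃ y ∈ s, ‖x - y‖ ≤ ε := by
  classical
  let P : Finset E → Prop := fun s => ↑s ⊆ A ∧ ∀ c ∈ s, ∀ d ∈ s, c ≠ d → ε ≤ ‖c - d‖
  have hbound : ∀ s, P s → (s.card : ℝ) ≤ (1 + 2 / ε) ^ finrank ℝ E := fun s hs =>
    card_le_of_separated_unit_ball s hε (fun c hc => hA c (hs.1 hc)) hs.2
  let K : Set ℕ := {k | ∃ s, P s ∧ s.card = k}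
  have hKne : K.Nonempty := ⟨0, ∅, ⟨by simp, by simp⟩, rfl⟩
  have hKbdd : BddAbove K := ⟨⌊(1 + 2 / ε) ^ finrank ℝ E⌋₊, by
    rintro k ⟨s, hs, rfl⟩
    exact Nat.le_floor (hbound s hs)⟩
  obtain ⟨s, hs, hcard⟩ := Nat.sSup_mem hKne hKbdd
  refine ⟨s, hs.1, hbound s hs, fun x hx => ?_⟩
  by_contra! hcon
  have hxs : x ∉ s := fun hxs => by
    have := hcon x hxs
    simp at this
    linarith
  have hP : P (insert x s) := by
    refine ⟨by simpa [Set.insert_subset_iff] using ⟨hx, hs.1⟩, fun c hc d hd hcd => ?_⟩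
    rw [Finset.mem_insert] at hc hd
    rcases hc with rfl | hc <;> rcases hd with rfl | hd
    · exact absurd rfl hcd
    · exact (hcon d hd).le
    · rw [norm_sub_rev]; exact (hcon c hc).le
    · exact hs.2 c hc d hd hcd
  have := le_csSup hKbdd ⟨_, hP, rfl⟩
  rw [Finset.card_insert_of_notMem hxs, hcard] at this
  omega

end Net

section Reduction

variable {n p : ℕ} {θ : unitInterval}

/-- The columns of a matrix, as vectors of the Euclidean space. -/
def columns (A : Matrix (Fin n) (Fin p) ℝ) (j : Fin p) : EuclideanSpace ℝ (Fin n) :=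
  WithLp.toLp 2 fun i => A i j

theorem hasLaw_columns {Ω : Type*} [MeasurableSpace Ω] {μ : Measure Ω}
    {X : Ω → Matrix (Fin n) (Fin p) ℝ} (hX : IsBernoulliGaussianMatrix μ θ X) :
    HasLaw (fun ω => columns (X ω)) (Measure.pi fun _ : Fin p => columnLaw n θ) μ := by
  have h := hX.indep.hasLaw_pi fun ij : Fin n × Fin p => hX.hasLaw ij.1 ij.2
  let Ψ : (Fin n × Fin p → ℝ) → Fin p → EuclideanSpace ℝ (Fin n) :=
    fun z j => WithLp.toLp 2 fun i => z (i, j)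
  let Φ : (Fin p → Fin n → ℝ) → Fin n × Fin p → ℝ := fun z ij => z ij.2 ij.1
  have hΨ : Measurable Ψ := measurable_pi_lambda _ fun j =>
    (WithLp.measurable_toLp 2 _).comp (measurable_pi_lambda _ fun i => measurable_pi_apply _)
  have hΦ : Measurable Φ := by fun_prop
  have hΦmap : (Measure.pi fun _ : Fin p => Measure.pi fun _ : Fin n => bernoulliGaussian θ).map Φ
      = Measure.pi fun _ : Fin n × Fin p => bernoulliGaussian θ := by
    symm
    refine Measure.pi_eq fun s hs => ?_
    rw [Measure.map_apply hΦ (MeasurableSet.univ_pi hs)]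
    have : Φ ⁻¹' (Set.univ.pi s) = Set.univ.pi fun j => Set.univ.pi fun i => s (i, j) := by
      ext z
      simp only [Set.mem_preimage, Set.mem_univ_pi, Φ]
      exact ⟨fun h j i => h (i, j), fun h ij => h ij.2 ij.1⟩
    rw [this, Measure.pi_pi]
    simp_rw [Measure.pi_pi]
    rw [Fintype.prod_prod_type_right]
  have hΨmap : (Measure.pi fun _ : Fin n × Fin p => bernoulliGaussian θ).map Ψ
      = Measure.pi fun _ : Fin p => columnLaw n θ := by
    rw [← hΦmap, Measure.map_map hΨ hΦ]
    have : Ψ ∘ Φ = fun z j => WithLp.toLp 2 (z j) := rfl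
    rw [this]
    exact Measure.pi_map_pi (f := fun _ : Fin p => WithLp.toLp 2)
      fun j => (WithLp.measurable_toLp 2 _).aemeasurable
  exact (⟨hΨ.aemeasurable, hΨmap⟩ : HasLaw Ψ _ _).comp h

/-- The mean fourth power of the coordinates of `T x`. -/
noncomputable def meanPowFour
    (T : EuclideanSpace ℝ (Fin n) →L[ℝ] EuclideanSpace ℝ (Fin n)) (x : EuclideanSpace ℝ (Fin n)) :
    ℝ :=
  (1 / n : ℝ) * ∑ i, (T x) i ^ 4

/-- The linear forms giving the coordinates of `T x`. -/
noncomputable def rowVector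
    (T : EuclideanSpace ℝ (Fin n) →L[ℝ] EuclideanSpace ℝ (Fin n)) (i : Fin n) :
    EuclideanSpace ℝ (Fin n) :=
  ContinuousLinearMap.adjoint T (EuclideanSpace.single i 1)

variable {T : EuclideanSpace ℝ (Fin n) →L[ℝ] EuclideanSpace ℝ (Fin n)}

theorem inner_rowVector (T : EuclideanSpace ℝ (Fin n) →L[ℝ] EuclideanSpace ℝ (Fin n)) (i : Fin n)
    (x : EuclideanSpace ℝ (Fin n)) : inner ℝ (rowVector T i) x = (T x) i := by
  rw [rowVector, ContinuousLinearMap.adjoint_inner_left, EuclideanSpace.inner_single_left]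
  simp

theorem norm_apply_of_mem_unitary
    (hT : T ∈ unitary (EuclideanSpace ℝ (Fin n) →L[ℝ] EuclideanSpace ℝ (Fin n)))
    (x : EuclideanSpace ℝ (Fin n)) : ‖T x‖ = ‖x‖ := by
  have h := (Unitary.mem_iff.1 hT).1
  rw [ContinuousLinearMap.star_eq_adjoint] at h
  have h2 : inner ℝ (T x) (T x) = inner ℝ x x := by
    rw [← ContinuousLinearMap.adjoint_inner_left]
    congr 1
    exact DFunLike.congr_fun h x
  rw [real_inner_self_eq_norm_sq, real_inner_self_eq_norm_sq] at h2
  exact (pow_left_inj₀ (norm_nonneg _) (norm_nonneg _) two_ne_zero).1 h2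

theorem norm_rowVector_of_mem_unitary
    (hT : T ∈ unitary (EuclideanSpace ℝ (Fin n) →L[ℝ] EuclideanSpace ℝ (Fin n))) (i : Fin n) :
    ‖rowVector T i‖ = 1 := by
  have hT' := Unitary.star_mem hT
  rw [ContinuousLinearMap.star_eq_adjoint] at hT'
  rw [rowVector, norm_apply_of_mem_unitary hT']
  simp

theorem norm_le_one_of_mem_unitary
    (hT : T ∈ unitary (EuclideanSpace ℝ (Fin n) →L[ℝ] EuclideanSpace ℝ (Fin n))) : ‖T‖ ≤ 1 :=
  T.opNorm_le_bound zero_le_one fun x => by rw [norm_apply_of_mem_unitary hT, one_mul]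

theorem meanPowFour_eq (T : EuclideanSpace ℝ (Fin n) →L[ℝ] EuclideanSpace ℝ (Fin n))
    (x : EuclideanSpace ℝ (Fin n)) :
    meanPowFour T x = (1 / n : ℝ) * ∑ i, (inner ℝ (rowVector T i) x) ^ 4 := by
  simp_rw [meanPowFour, inner_rowVector]

theorem integrable_meanPowFour
    (T : EuclideanSpace ℝ (Fin n) →L[ℝ] EuclideanSpace ℝ (Fin n)) :
    Integrable (meanPowFour T) (columnLaw n θ) := by
  have : meanPowFour T = fun x => (1 / n : ℝ) * ∑ i, (inner ℝ (rowVector T i) x) ^ 4 :=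
    funext fun x => meanPowFour_eq T x
  rw [this]
  exact (integrable_finsetSum _ fun i _ => integrable_inner_pow _ 4).const_mul _

theorem integral_meanPowFour
    (T : EuclideanSpace ℝ (Fin n) →L[ℝ] EuclideanSpace ℝ (Fin n)) :
    ∫ x, meanPowFour T x ∂(columnLaw n θ)
      = (1 / n : ℝ) * ∑ i, ∫ x, (inner ℝ (rowVector T i) x) ^ 4 ∂(columnLaw n θ) := by
  simp_rw [meanPowFour_eq]
  rw [integral_const_mul, integral_finsetSum _ fun i _ => integrable_inner_pow _ 4]

theorem l4NormPow_mul_eq (hn : 0 < n) (W : Matrix (Fin n) (Fin n) ℝ)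
    (A : Matrix (Fin n) (Fin p) ℝ) :
    l4NormPow (W * A)
      = n * ∑ j, meanPowFour (Matrix.toEuclideanCLM (𝕜 := ℝ) W) (columns A j) := by
  have hn' : (n : ℝ) ≠ 0 := by positivity
  simp only [l4NormPow, meanPowFour]
  rw [← Finset.mul_sum, ← mul_assoc, mul_one_div_cancel hn', one_mul, Finset.sum_comm]
  refine Finset.sum_congr rfl fun j _ => Finset.sum_congr rfl fun i _ => ?_
  simp [columns, Matrix.mul_apply, Matrix.mulVec, dotProduct]

theorem toEuclideanCLM_mem_unitary (W : Matrix.orthogonalGroup (Fin n) ℝ) :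
    Matrix.toEuclideanCLM (𝕜 := ℝ) (W : Matrix (Fin n) (Fin n) ℝ)
      ∈ unitary (EuclideanSpace ℝ (Fin n) →L[ℝ] EuclideanSpace ℝ (Fin n)) := by
  obtain ⟨h1, h2⟩ := Unitary.mem_iff.1 W.2
  rw [Unitary.mem_iff]
  constructor
  · rw [← map_star, ← map_mul, h1, map_one]
  · rw [← map_star, ← map_mul, h2, map_one]

/-- To bound the tail of the supremum it suffices to bound, off a set of small measure, the
deviations of the empirical means of `meanPowFour T` over all orthogonal `T`. -/
theorem measureReal_le_supDeviation_le {Ω : Type*} [MeasurableSpace Ω] {μ : Measure Ω}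
    [IsProbabilityMeasure μ] {X : Ω → Matrix (Fin n) (Fin p) ℝ} (hn : 0 < n) (hp : 0 < p)
    (hX : IsBernoulliGaussianMatrix μ θ X) {δ δ' : ℝ} (hδ : δ' < δ)
    (bad : Set (Fin p → EuclideanSpace ℝ (Fin n)))
    (h : ∀ x ∉ bad, ∀ T ∈ unitary (EuclideanSpace ℝ (Fin n) →L[ℝ] EuclideanSpace ℝ (Fin n)),
      |(1 / p : ℝ) * ∑ j, meanPowFour T (x j) - ∫ y, meanPowFour T y ∂(columnLaw n θ)| ≤ δ') :
    μ.real {ω | δ ≤ supDeviation μ X ω}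
      ≤ (Measure.pi fun _ : Fin p => columnLaw n θ).real bad := by
  have hlaw := hasLaw_columns hX
  have hn' : (n : ℝ) ≠ 0 := by positivity
  have hp' : (p : ℝ) ≠ 0 := by positivity
  have hlawj : ∀ j, HasLaw (fun ω => columns (X ω) j) (columnLaw n θ) μ := fun j =>
    (measurePreserving_eval (fun _ : Fin p => columnLaw n θ) j).hasLaw.comp hlaw
  have hmean : ∀ T : EuclideanSpace ℝ (Fin n) →L[ℝ] EuclideanSpace ℝ (Fin n),
      ∫ ω, (∑ j, meanPowFour T (columns (X ω) j)) ∂μ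
        = p * ∫ y, meanPowFour T y ∂(columnLaw n θ) := fun T => by
    have hi : ∀ j, Integrable (fun ω => meanPowFour T (columns (X ω) j)) μ := fun j => by
      refine Integrable.comp_aemeasurable (g := meanPowFour T) ?_ (hlawj j).aemeasurable
      rw [(hlawj j).map_eq]
      exact integrable_meanPowFour T
    rw [integral_finsetSum _ fun j _ => hi j]
    have : ∀ j, ∫ ω, meanPowFour T (columns (X ω) j) ∂μ
        = ∫ y, meanPowFour T y ∂(columnLaw n θ) := fun j =>
      (hlawj j).integral_comp (integrable_meanPowFour T).aestronglyMeasurable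
    simp_rw [this]
    simp
  have hsub : {ω | δ ≤ supDeviation μ X ω} ⊆ (fun ω => columns (X ω)) ⁻¹' bad := by
    intro ω hω
    by_contra hbad
    refine absurd hω (not_le.2 (lt_of_le_of_lt (ciSup_le fun W => ?_) hδ))
    refine le_trans (le_of_eq ?_) (h _ hbad _ (toEuclideanCLM_mem_unitary W))
    simp_rw [l4NormPow_mul_eq hn]
    rw [integral_const_mul, hmean, ← mul_sub, abs_mul, abs_of_nonneg (Nat.cast_nonneg n),
      ← mul_assoc]
    have h1 : 1 / ((n : ℝ) * p) * n = 1 / p := by field_simp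
    rw [h1, ← abs_of_nonneg (show (0 : ℝ) ≤ 1 / p by positivity), ← abs_mul,
      abs_of_nonneg (show (0 : ℝ) ≤ 1 / p by positivity), mul_sub, ← mul_assoc,
      one_div_mul_cancel hp', one_mul]
  refine (measureReal_mono hsub).trans ?_
  have := Measure.le_map_apply hlaw.aemeasurable bad
  rw [hlaw.map_eq] at this
  exact ENNReal.toReal_mono (measure_ne_top _ _) this

end Reduction

section Truncation

variable {n p : ℕ} {θ : unitInterval}

/-- The vectors all of whose coordinates are at most `L` in absolute value. -/
def coordBox (n : ℕ) (L : ℝ) : Set (EuclideanSpace ℝ (Fin n)) := {x | ∀ i, |x i| ≤ L}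

theorem measurableSet_coordBox (n : ℕ) (L : ℝ) : MeasurableSet (coordBox n L) := by
  have : coordBox n L = ⋂ i, {x | |x i| ≤ L} := by ext; simp [coordBox]
  rw [this]
  exact MeasurableSet.iInter fun i => measurableSet_le (by fun_prop) measurable_const

theorem columnLaw_real_compl_coordBox_le {L : ℝ} (hL : 0 ≤ L) :
    (columnLaw n θ).real (coordBox n L)ᶜ ≤ 2 * n * θ * Real.exp (-(L ^ 2 / 2)) := by
  have : (coordBox n L)ᶜ = ⋃ i, {x | L < |x i|} := by ext; simp [coordBox]
  rw [this]
  refine (measureReal_iUnion_fintype_le _).trans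
    ((Finset.sum_le_sum fun i _ => columnLaw_coord_abs_gt_le i hL).trans (le_of_eq ?_))
  simp
  ring

theorem norm_sq_le_of_mem_coordBox {L : ℝ} {x : EuclideanSpace ℝ (Fin n)} (hx : x ∈ coordBox n L) :
    ‖x‖ ^ 2 ≤ n * L ^ 2 := by
  rw [EuclideanSpace.norm_sq_eq]
  refine (Finset.sum_le_sum fun i _ => pow_le_pow_left₀ (norm_nonneg _) (hx i) 2).trans
    (le_of_eq ?_)
  simp

theorem sq_apply_le_norm_sq (x : EuclideanSpace ℝ (Fin n)) (i : Fin n) : x i ^ 2 ≤ ‖x‖ ^ 2 := by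
  rw [EuclideanSpace.norm_sq_eq, ← sq_abs, ← Real.norm_eq_abs]
  exact Finset.single_le_sum (f := fun i => ‖x i‖ ^ 2) (fun i _ => sq_nonneg _) (Finset.mem_univ i)

theorem sum_pow_four_le (x : EuclideanSpace ℝ (Fin n)) : ∑ i, x i ^ 4 ≤ ‖x‖ ^ 4 := by
  have h : ‖x‖ ^ 4 = ∑ i, x i ^ 2 * ‖x‖ ^ 2 := by
    rw [← Finset.sum_mul]
    have := EuclideanSpace.norm_sq_eq x
    simp only [Real.norm_eq_abs, sq_abs] at this
    rw [← this]; ring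
  rw [h]
  refine Finset.sum_le_sum fun i _ => ?_
  nlinarith [sq_apply_le_norm_sq x i, sq_nonneg (x i)]

variable {T T' : EuclideanSpace ℝ (Fin n) →L[ℝ] EuclideanSpace ℝ (Fin n)}

theorem meanPowFour_nonneg (T : EuclideanSpace ℝ (Fin n) →L[ℝ] EuclideanSpace ℝ (Fin n))
    (x : EuclideanSpace ℝ (Fin n)) : 0 ≤ meanPowFour T x := by
  unfold meanPowFour
  exact mul_nonneg (by positivity) (Finset.sum_nonneg fun i _ => by positivity)

theorem norm_apply_le_of_norm_le_one (hT : ‖T‖ ≤ 1) (x : EuclideanSpace ℝ (Fin n)) :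
    ‖T x‖ ≤ ‖x‖ := by
  simpa using (T.le_opNorm x).trans (mul_le_mul_of_nonneg_right hT (norm_nonneg x))

theorem meanPowFour_le (hT : ‖T‖ ≤ 1) (x : EuclideanSpace ℝ (Fin n)) :
    meanPowFour T x ≤ (1 / n : ℝ) * ‖x‖ ^ 4 := by
  unfold meanPowFour
  gcongr
  exact (sum_pow_four_le _).trans
    (pow_le_pow_left₀ (norm_nonneg _) (norm_apply_le_of_norm_le_one hT x) 4)

theorem abs_meanPowFour_sub_le (hT : ‖T‖ ≤ 1) (hT' : ‖T'‖ ≤ 1) (x : EuclideanSpace ℝ (Fin n)) :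
    |meanPowFour T x - meanPowFour T' x| ≤ 4 * ‖T - T'‖ * ((1 / n : ℝ) * ‖x‖ ^ 4) := by
  unfold meanPowFour
  rw [← mul_sub, abs_mul, abs_of_nonneg (show (0 : ℝ) ≤ 1 / n by positivity),
    ← Finset.sum_sub_distrib]
  set a := T x with ha
  set c := T' x with hc
  have hax : ‖a‖ ≤ ‖x‖ := norm_apply_le_of_norm_le_one hT x
  have hcx : ‖c‖ ≤ ‖x‖ := norm_apply_le_of_norm_le_one hT' x
  have hx0 := norm_nonneg x
  have hac : ‖a - c‖ ≤ ‖T - T'‖ * ‖x‖ := (T - T').le_opNorm x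
  have hac' : ‖a + c‖ ≤ 2 * ‖x‖ := (norm_add_le a c).trans (by linarith)
  have hterm : ∀ i, |a i ^ 4 - c i ^ 4| ≤ 2 * ‖x‖ ^ 2 * (|(a - c) i| * |(a + c) i|) := fun i => by
    have hfac : a i ^ 4 - c i ^ 4 = (a i ^ 2 + c i ^ 2) * ((a - c) i * (a + c) i) := by
      simp only [PiLp.sub_apply, PiLp.add_apply]; ring
    rw [hfac, abs_mul, abs_mul, abs_of_nonneg (by positivity : 0 ≤ a i ^ 2 + c i ^ 2)]
    refine mul_le_mul_of_nonneg_right ?_ (by positivity)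
    have h1 := (sq_apply_le_norm_sq a i).trans (pow_le_pow_left₀ (norm_nonneg _) hax 2)
    have h2 := (sq_apply_le_norm_sq c i).trans (pow_le_pow_left₀ (norm_nonneg _) hcx 2)
    linarith
  have hcs : ∑ i, |(a - c) i| * |(a + c) i| ≤ ‖a - c‖ * ‖a + c‖ := by
    rw [EuclideanSpace.norm_eq, EuclideanSpace.norm_eq]
    exact Real.sum_mul_le_sqrt_mul_sqrt _ _ _
  have hsum : |∑ i, (a i ^ 4 - c i ^ 4)| ≤ 4 * ‖T - T'‖ * ‖x‖ ^ 4 := by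
    calc |∑ i, (a i ^ 4 - c i ^ 4)| ≤ ∑ i, |a i ^ 4 - c i ^ 4| := Finset.abs_sum_le_sum_abs _ _
      _ ≤ ∑ i, 2 * ‖x‖ ^ 2 * (|(a - c) i| * |(a + c) i|) := Finset.sum_le_sum fun i _ => hterm i
      _ = 2 * ‖x‖ ^ 2 * ∑ i, |(a - c) i| * |(a + c) i| := by rw [Finset.mul_sum]
      _ ≤ 2 * ‖x‖ ^ 2 * ((‖T - T'‖ * ‖x‖) * (2 * ‖x‖)) := by
        gcongr
        exact hcs.trans (by gcongr)
      _ = _ := by ring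
  calc _ ≤ (1 / n : ℝ) * (4 * ‖T - T'‖ * ‖x‖ ^ 4) := by gcongr
    _ = _ := by ring

theorem meanPowFour_sq_le (hn : 0 < n)
    (T : EuclideanSpace ℝ (Fin n) →L[ℝ] EuclideanSpace ℝ (Fin n)) (x : EuclideanSpace ℝ (Fin n)) :
    meanPowFour T x ^ 2 ≤ (1 / n : ℝ) * ∑ i, (inner ℝ (rowVector T i) x) ^ 8 := by
  have hn' : (0 : ℝ) < n := by exact_mod_cast hn
  have h := sq_sum_le_card_mul_sum_sq (s := Finset.univ)
    (f := fun i => (inner ℝ (rowVector T i) x) ^ 4)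
  simp_rw [← pow_mul] at h
  norm_num at h
  rw [meanPowFour_eq, mul_pow]
  calc (1 / n : ℝ) ^ 2 * (∑ i, (inner ℝ (rowVector T i) x) ^ 4) ^ 2
      ≤ (1 / n : ℝ) ^ 2 * (n * ∑ i, (inner ℝ (rowVector T i) x) ^ 8) := by gcongr
    _ = _ := by field_simp

theorem integrable_meanPowFour_sq (hn : 0 < n)
    (T : EuclideanSpace ℝ (Fin n) →L[ℝ] EuclideanSpace ℝ (Fin n)) :
    Integrable (fun x => meanPowFour T x ^ 2) (columnLaw n θ) := by
  refine ((integrable_finsetSum Finset.univ fun i _ =>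
    integrable_inner_pow (rowVector T i) 8).const_mul (1 / n : ℝ)).mono'
    ((integrable_meanPowFour T).aestronglyMeasurable.pow 2) (Filter.Eventually.of_forall fun x => ?_)
  rw [Real.norm_eq_abs, abs_of_nonneg (sq_nonneg _)]
  exact meanPowFour_sq_le hn T x

theorem average_le_of_forall_le (hn : 0 < n) {a : Fin n → ℝ} {C : ℝ} (h : ∀ i, a i ≤ C) :
    (1 / n : ℝ) * ∑ i, a i ≤ C := by
  have hn' : (0 : ℝ) < n := by exact_mod_cast hn
  have := Finset.sum_le_sum fun i (_ : i ∈ Finset.univ) => h i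
  simp only [Finset.sum_const, Finset.card_univ, Fintype.card_fin, nsmul_eq_mul] at this
  calc _ ≤ (1 / n : ℝ) * (n * C) := by gcongr
    _ = C := by field_simp

theorem integral_meanPowFour_sq_le (hn : 0 < n)
    (hT : T ∈ unitary (EuclideanSpace ℝ (Fin n) →L[ℝ] EuclideanSpace ℝ (Fin n))) :
    ∫ x, meanPowFour T x ^ 2 ∂(columnLaw n θ) ≤ 40320 * θ := by
  have h := integral_mono (integrable_meanPowFour_sq (θ := θ) hn T)
    ((integrable_finsetSum Finset.univ fun i _ =>
      integrable_inner_pow (rowVector T i) 8).const_mul (1 / n : ℝ)) (meanPowFour_sq_le hn T)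
  rw [integral_const_mul, integral_finsetSum _ fun i _ => integrable_inner_pow _ 8] at h
  exact h.trans (average_le_of_forall_le hn fun i =>
    integral_inner_pow_eight_le (norm_rowVector_of_mem_unitary hT i).le)

theorem integral_meanPowFour_le (hn : 0 < n)
    (hT : T ∈ unitary (EuclideanSpace ℝ (Fin n) →L[ℝ] EuclideanSpace ℝ (Fin n))) :
    ∫ x, meanPowFour T x ∂(columnLaw n θ) ≤ 16 / 5 * θ := by
  rw [integral_meanPowFour]
  exact average_le_of_forall_le hn fun i =>
    integral_inner_pow_four_le (norm_rowVector_of_mem_unitary hT i)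

/-- `meanPowFour T`, set to zero off the box `coordBox n L`. -/
noncomputable def truncMeanPowFour (L : ℝ)
    (T : EuclideanSpace ℝ (Fin n) →L[ℝ] EuclideanSpace ℝ (Fin n)) :
    EuclideanSpace ℝ (Fin n) → ℝ :=
  (coordBox n L).indicator (meanPowFour T)

theorem measurable_meanPowFour (T : EuclideanSpace ℝ (Fin n) →L[ℝ] EuclideanSpace ℝ (Fin n)) :
    Measurable (meanPowFour T) := by
  have : meanPowFour T = fun x => (1 / n : ℝ) * ∑ i, (inner ℝ (rowVector T i) x) ^ 4 :=
    funext fun x => meanPowFour_eq T x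
  rw [this]
  fun_prop

theorem measurable_truncMeanPowFour (L : ℝ)
    (T : EuclideanSpace ℝ (Fin n) →L[ℝ] EuclideanSpace ℝ (Fin n)) :
    Measurable (truncMeanPowFour L T) :=
  (measurable_meanPowFour T).indicator (measurableSet_coordBox n L)

theorem truncMeanPowFour_nonneg (L : ℝ)
    (T : EuclideanSpace ℝ (Fin n) →L[ℝ] EuclideanSpace ℝ (Fin n)) (x : EuclideanSpace ℝ (Fin n)) :
    0 ≤ truncMeanPowFour L T x :=
  Set.indicator_nonneg (fun _ _ => meanPowFour_nonneg T _) x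

theorem truncMeanPowFour_le_meanPowFour (L : ℝ)
    (T : EuclideanSpace ℝ (Fin n) →L[ℝ] EuclideanSpace ℝ (Fin n)) (x : EuclideanSpace ℝ (Fin n)) :
    truncMeanPowFour L T x ≤ meanPowFour T x :=
  Set.indicator_le_self' (fun _ _ => meanPowFour_nonneg T _) x

theorem average_norm_pow_four_le_of_mem_coordBox {L : ℝ} {x : EuclideanSpace ℝ (Fin n)}
    (hx : x ∈ coordBox n L) : (1 / n : ℝ) * ‖x‖ ^ 4 ≤ n * L ^ 4 := by
  rcases Nat.eq_zero_or_pos n with rfl | hn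
  · simp
  have hn' : (0 : ℝ) < n := by exact_mod_cast hn
  have h := pow_le_pow_left₀ (sq_nonneg _) (norm_sq_le_of_mem_coordBox hx) 2
  calc (1 / n : ℝ) * ‖x‖ ^ 4 = (1 / n : ℝ) * (‖x‖ ^ 2) ^ 2 := by ring
    _ ≤ (1 / n : ℝ) * (n * L ^ 2) ^ 2 := by gcongr
    _ = n * L ^ 4 := by field_simp

theorem truncMeanPowFour_le {L : ℝ} (hT : ‖T‖ ≤ 1) (x : EuclideanSpace ℝ (Fin n)) :
    truncMeanPowFour L T x ≤ n * L ^ 4 := by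
  by_cases hx : x ∈ coordBox n L
  · simp only [truncMeanPowFour, Set.indicator_of_mem hx]
    exact (meanPowFour_le hT x).trans (average_norm_pow_four_le_of_mem_coordBox hx)
  · simp only [truncMeanPowFour, Set.indicator_of_notMem hx]
    positivity

theorem abs_truncMeanPowFour_sub_le {L : ℝ} (hT : ‖T‖ ≤ 1) (hT' : ‖T'‖ ≤ 1)
    (x : EuclideanSpace ℝ (Fin n)) :
    |truncMeanPowFour L T x - truncMeanPowFour L T' x| ≤ 4 * ‖T - T'‖ * (n * L ^ 4) := by
  by_cases hx : x ∈ coordBox n L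
  · simp only [truncMeanPowFour, Set.indicator_of_mem hx]
    refine (abs_meanPowFour_sub_le hT hT' x).trans ?_
    exact mul_le_mul_of_nonneg_left (average_norm_pow_four_le_of_mem_coordBox hx) (by positivity)
  · simp only [truncMeanPowFour, Set.indicator_of_notMem hx, sub_self, abs_zero]
    positivity

theorem integrable_truncMeanPowFour (L : ℝ)
    (T : EuclideanSpace ℝ (Fin n) →L[ℝ] EuclideanSpace ℝ (Fin n)) :
    Integrable (truncMeanPowFour L T) (columnLaw n θ) :=
  (integrable_meanPowFour T).indicator (measurableSet_coordBox n L)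

theorem integral_truncMeanPowFour_sq_le (hn : 0 < n) (L : ℝ)
    (hT : T ∈ unitary (EuclideanSpace ℝ (Fin n) →L[ℝ] EuclideanSpace ℝ (Fin n))) :
    ∫ x, truncMeanPowFour L T x ^ 2 ∂(columnLaw n θ) ≤ 40320 * θ := by
  refine le_trans (integral_mono_of_nonneg (Filter.Eventually.of_forall fun x => sq_nonneg _)
    (integrable_meanPowFour_sq hn T) (Filter.Eventually.of_forall fun x => ?_))
    (integral_meanPowFour_sq_le hn hT)
  exact pow_le_pow_left₀ (truncMeanPowFour_nonneg L T x) (truncMeanPowFour_le_meanPowFour L T x) 2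

/-- The bias caused by the truncation is at most the whole expectation. -/
theorem integral_sub_integral_trunc_le (hn : 0 < n) (L : ℝ)
    (hT : T ∈ unitary (EuclideanSpace ℝ (Fin n) →L[ℝ] EuclideanSpace ℝ (Fin n))) :
    ∫ x, meanPowFour T x ∂(columnLaw n θ) - ∫ x, truncMeanPowFour L T x ∂(columnLaw n θ)
      ≤ 16 / 5 * θ := by
  have h1 := integral_meanPowFour_le (θ := θ) hn hT
  have h2 : 0 ≤ ∫ x, truncMeanPowFour L T x ∂(columnLaw n θ) :=
    integral_nonneg (truncMeanPowFour_nonneg L T)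
  linarith

theorem integral_sub_integral_trunc_le_exp (hn : 0 < n) {L : ℝ} (hL : 0 ≤ L)
    (hT : T ∈ unitary (EuclideanSpace ℝ (Fin n) →L[ℝ] EuclideanSpace ℝ (Fin n))) :
    ∫ x, meanPowFour T x ∂(columnLaw n θ) - ∫ x, truncMeanPowFour L T x ∂(columnLaw n θ)
      ≤ 20161 * θ * √n * Real.exp (-(L ^ 2 / 4)) := by
  have hn' : (0 : ℝ) < n := by exact_mod_cast hn
  set s := √n * Real.exp (-(L ^ 2 / 4)) with hs
  have hspos : 0 < s := by positivity
  have hs2 : s ^ 2 = n * Real.exp (-(L ^ 2 / 2)) := by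
    rw [hs, mul_pow, Real.sq_sqrt hn'.le, ← Real.exp_nat_mul]
    congr 2
    push_cast
    ring
  have hGc := (measurableSet_coordBox n L).compl
  have hi2 := integrable_meanPowFour_sq (θ := θ) hn T
  have hind : Integrable ((coordBox n L)ᶜ.indicator fun _ => (1 : ℝ)) (columnLaw n θ) :=
    (integrable_const 1).indicator hGc
  rw [← integral_sub (integrable_meanPowFour T) (integrable_truncMeanPowFour L T)]
  have h := integral_mono ((integrable_meanPowFour (θ := θ) T).sub (integrable_truncMeanPowFour L T))
    ((hi2.const_mul (s / 2)).add (hind.const_mul (1 / (2 * s)))) fun x => by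
      simp only [Pi.sub_apply, Pi.add_apply]
      by_cases hx : x ∈ coordBox n L
      · simp only [truncMeanPowFour, Set.indicator_of_mem hx, sub_self]
        rw [Set.indicator_of_notMem (by simpa using hx)]
        positivity
      · simp only [truncMeanPowFour, Set.indicator_of_notMem hx, sub_zero]
        rw [Set.indicator_of_mem (by simpa using hx)]
        have : s / 2 * meanPowFour T x ^ 2 + 1 / (2 * s) * 1 - meanPowFour T x
            = (s * meanPowFour T x - 1) ^ 2 / (2 * s) := by field_simp; ring
        have : 0 ≤ (s * meanPowFour T x - 1) ^ 2 / (2 * s) := by positivity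
        linarith
  simp only [Pi.sub_apply, Pi.add_apply] at h
  rw [integral_add (hi2.const_mul (s / 2)) (hind.const_mul (1 / (2 * s))), integral_const_mul,
    integral_const_mul, integral_indicator_const _ hGc, smul_eq_mul, mul_one] at h
  have h1 := mul_le_mul_of_nonneg_left (integral_meanPowFour_sq_le (θ := θ) hn hT)
    (show 0 ≤ s / 2 by positivity)
  have h2 := mul_le_mul_of_nonneg_left (columnLaw_real_compl_coordBox_le (n := n) (θ := θ) hL)
    (show 0 ≤ 1 / (2 * s) by positivity)
  have h3 : 1 / (2 * s) * (2 * n * θ * Real.exp (-(L ^ 2 / 2))) = θ * s := by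
    have : 2 * n * (θ : ℝ) * Real.exp (-(L ^ 2 / 2)) = 2 * θ * s ^ 2 := by rw [hs2]; ring
    rw [this]; field_simp
  rw [h3] at h2
  calc _ ≤ _ := h
    _ ≤ s / 2 * (40320 * θ) + θ * s := add_le_add h1 h2
    _ = _ := by rw [hs]; ring

end Truncation

section ExplicitTail

variable {n p : ℕ} {θ : unitInterval}

theorem pi_real_exists_notMem_coordBox_le {L : ℝ} (hL : 0 ≤ L) :
    (Measure.pi fun _ : Fin p => columnLaw n θ).real {x | ∃ j, x j ∈ (coordBox n L)ᶜ}
      ≤ 2 * n * p * θ * Real.exp (-(L ^ 2 / 2)) := by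
  refine (pi_real_exists_mem_le p (measurableSet_coordBox n L).compl).trans ?_
  calc _ ≤ (p : ℝ) * (2 * n * θ * Real.exp (-(L ^ 2 / 2))) := by
        gcongr
        exact columnLaw_real_compl_coordBox_le hL
    _ = _ := by ring

theorem abs_average_sub_average_le (hp : 0 < p) {f g : Fin p → ℝ} {C : ℝ}
    (h : ∀ j, |f j - g j| ≤ C) :
    |(1 / p : ℝ) * ∑ j, f j - (1 / p : ℝ) * ∑ j, g j| ≤ C := by
  rw [← mul_sub, abs_mul, abs_of_nonneg (show (0 : ℝ) ≤ 1 / p by positivity),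
    ← Finset.sum_sub_distrib]
  calc _ ≤ (1 / p : ℝ) * ∑ j, |f j - g j| := by
        gcongr
        exact Finset.abs_sum_le_sum_abs _ _
    _ ≤ C := average_le_of_forall_le hp h

theorem abs_integral_sub_integral_le {S : Type*} [MeasurableSpace S] {ν : Measure S}
    [IsProbabilityMeasure ν] {f g : S → ℝ} (hf : Integrable f ν) (hg : Integrable g ν) {C : ℝ}
    (h : ∀ s, |f s - g s| ≤ C) : |∫ s, f s ∂ν - ∫ s, g s ∂ν| ≤ C := by
  rw [← integral_sub hf hg]
  have := norm_integral_le_of_norm_le_const (μ := ν) (f := fun s => f s - g s) (C := C)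
    (Filter.Eventually.of_forall h)
  simpa using this

theorem sum_trunc_eq_of_forall_mem {L : ℝ} {x : Fin p → EuclideanSpace ℝ (Fin n)}
    (hx : ∀ j, x j ∈ coordBox n L)
    (T : EuclideanSpace ℝ (Fin n) →L[ℝ] EuclideanSpace ℝ (Fin n)) :
    ∑ j, meanPowFour T (x j) = ∑ j, truncMeanPowFour L T (x j) :=
  Finset.sum_congr rfl fun j _ => (Set.indicator_of_mem (hx j) _).symm

theorem finrank_continuousLinearMap_euclideanSpace (n : ℕ) :
    Module.finrank ℝ (EuclideanSpace ℝ (Fin n) →L[ℝ] EuclideanSpace ℝ (Fin n)) = n ^ 2 := by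
  rw [← (LinearMap.toContinuousLinearMap (𝕜 := ℝ) (E := EuclideanSpace ℝ (Fin n))
    (F' := EuclideanSpace ℝ (Fin n))).finrank_eq, Module.finrank_linearMap, finrank_euclideanSpace_fin,
    sq]

variable {Ω : Type*} [MeasurableSpace Ω] {μ : Measure Ω} [IsProbabilityMeasure μ]
  {X : Ω → Matrix (Fin n) (Fin p) ℝ}

theorem measureReal_le_supDeviation_le_of_large (hn : 0 < n) (hp : 0 < p)
    (hX : IsBernoulliGaussianMatrix μ θ X) {L δ : ℝ} (hL : 0 ≤ L)
    (hδ : n * L ^ 4 + 16 / 5 * θ < δ) :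
    μ.real {ω | δ ≤ supDeviation μ X ω} ≤ 2 * n * p * θ * Real.exp (-(L ^ 2 / 2)) := by
  refine (measureReal_le_supDeviation_le hn hp hX hδ {x | ∃ j, x j ∈ (coordBox n L)ᶜ} ?_).trans
    (pi_real_exists_notMem_coordBox_le hL)
  intro x hx T hT
  simp only [Set.mem_ofPred_eq, not_exists, Set.mem_compl_iff, not_not] at hx
  have h1 : (1 / p : ℝ) * ∑ j, meanPowFour T (x j) ≤ n * L ^ 4 := by
    rw [sum_trunc_eq_of_forall_mem hx]
    exact average_le_of_forall_le hp fun j => truncMeanPowFour_le (norm_le_one_of_mem_unitary hT) _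
  have h2 : 0 ≤ (1 / p : ℝ) * ∑ j, meanPowFour T (x j) :=
    mul_nonneg (by positivity) (Finset.sum_nonneg fun j _ => meanPowFour_nonneg T _)
  have h3 := integral_meanPowFour_le (θ := θ) hn hT
  have h4 : 0 ≤ ∫ y, meanPowFour T y ∂(columnLaw n θ) := integral_nonneg (meanPowFour_nonneg T)
  have h5 : 0 ≤ n * L ^ 4 := by positivity
  have h6 := θ.2.1
  rw [abs_le]
  constructor <;> linarith

theorem measureReal_le_supDeviation_le_net (hn : 0 < n) (hp : 0 < p)
    (hX : IsBernoulliGaussianMatrix μ θ X) {L δ t ε β : ℝ} (hL : 0 < L) (ht : 0 < t) (hε : 0 < ε)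
    (hβ : ∀ T ∈ unitary (EuclideanSpace ℝ (Fin n) →L[ℝ] EuclideanSpace ℝ (Fin n)),
      ∫ x, meanPowFour T x ∂(columnLaw n θ) - ∫ x, truncMeanPowFour L T x ∂(columnLaw n θ) ≤ β)
    (hδ : t + 8 * ε * (n * L ^ 4) + β < δ) :
    μ.real {ω | δ ≤ supDeviation μ X ω}
      ≤ (1 + 2 / ε) ^ (n ^ 2) *
          (2 * Real.exp (-(3 * p * t ^ 2 / (16 * (40320 * θ) + 4 * (n * L ^ 4) * t))))
        + 2 * n * p * θ * Real.exp (-(L ^ 2 / 2)) := by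
  obtain ⟨s, hsA, hcard, hs⟩ := exists_finset_net
    (A := {T | T ∈ unitary (EuclideanSpace ℝ (Fin n) →L[ℝ] EuclideanSpace ℝ (Fin n))})
    (fun T hT => norm_le_one_of_mem_unitary hT) hε
  rw [finrank_continuousLinearMap_euclideanSpace] at hcard
  set b := (n : ℝ) * L ^ 4 with hb
  have hbpos : 0 < b := by positivity
  set B : (EuclideanSpace ℝ (Fin n) →L[ℝ] EuclideanSpace ℝ (Fin n)) →
      Set (Fin p → EuclideanSpace ℝ (Fin n)) := fun T =>
    {x | t ≤ |(1 / p : ℝ) * ∑ j, truncMeanPowFour L T (x j)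
      - ∫ y, truncMeanPowFour L T y ∂(columnLaw n θ)|} with hB
  refine (measureReal_le_supDeviation_le hn hp hX hδ
    ((⋃ T ∈ s, B T) ∪ {x | ∃ j, x j ∈ (coordBox n L)ᶜ}) ?_).trans
    ((measureReal_union_le _ _).trans
      (add_le_add ?_ (pi_real_exists_notMem_coordBox_le hL.le)))
  · intro x hx T hT
    simp only [Set.mem_union, Set.mem_iUnion, not_or, not_exists] at hx
    obtain ⟨hx1, hx2⟩ := hx
    simp only [Set.mem_ofPred_eq, not_exists, Set.mem_compl_iff, not_not] at hx2
    rw [sum_trunc_eq_of_forall_mem hx2]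
    obtain ⟨T', hT's, hTT'⟩ := hs T hT
    have hT' := hsA hT's
    have hnear := hx1 T' hT's
    rw [hB, Set.mem_ofPred_eq, not_le] at hnear
    have hlip : ∀ y, |truncMeanPowFour L T y - truncMeanPowFour L T' y| ≤ 4 * ε * b := fun y => by
      refine (abs_truncMeanPowFour_sub_le (norm_le_one_of_mem_unitary hT)
        (norm_le_one_of_mem_unitary hT') y).trans ?_
      gcongr
    have h1 := abs_average_sub_average_le hp fun j => hlip (x j)
    have h2 := abs_integral_sub_integral_le (integrable_truncMeanPowFour (θ := θ) L T)
      (integrable_truncMeanPowFour L T') hlip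
    have h3 := hβ T hT
    have h4 := integral_mono (integrable_truncMeanPowFour (θ := θ) L T) (integrable_meanPowFour T)
      (truncMeanPowFour_le_meanPowFour L T)
    rw [abs_lt] at hnear
    rw [abs_le] at h1 h2 ⊢
    constructor <;> linarith
  · refine (measureReal_biUnion_finset_le s B).trans ?_
    have hbern : ∀ T ∈ s, (Measure.pi fun _ : Fin p => columnLaw n θ).real (B T)
        ≤ 2 * Real.exp (-(3 * p * t ^ 2 / (16 * (40320 * θ) + 4 * b * t))) := fun T hT =>
      pi_real_abs_mean_sub_ge_le hp (measurable_truncMeanPowFour L T)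
        (truncMeanPowFour_nonneg L T)
        (truncMeanPowFour_le (norm_le_one_of_mem_unitary (hsA hT)))
        (integral_truncMeanPowFour_sq_le hn L (hsA hT)) hbpos
        (mul_nonneg (by norm_num) θ.2.1) ht
    refine (Finset.sum_le_sum hbern).trans ?_
    rw [Finset.sum_const, nsmul_eq_mul]
    gcongr

theorem two_mul_net_card_le {n : ℕ} {p b δ : ℝ} (hn : 1 ≤ n) (hp : 2 ≤ p) (hb : 0 < b) (hδ : 0 < δ)
    (hx : 1 / 14.9 ≤ b / δ) :
    (1 + 2 / (0.046 * δ / b)) ^ (n ^ 2) * 2 ≤ (60 * p * (b / δ)) ^ (n ^ 2) := by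
  have h2ε : 2 / (0.046 * δ / b) = 2 / 0.046 * (b / δ) := by field_simp
  have hbase : (1 + 2 / 0.046 * (b / δ)) * 2 ≤ 60 * p * (b / δ) := by
    norm_num at hx ⊢
    nlinarith
  rw [h2ε]
  have hx0 : 0 < b / δ := by positivity
  refine le_trans ?_ (pow_le_pow_left₀ (by positivity) hbase (n ^ 2))
  rw [mul_pow]
  gcongr
  exact le_self_pow₀ (by norm_num) (by positivity)

/-- When the truncation bias is not negligible, the union bound over a net is vacuous. -/
theorem exponent_nonneg_of_bias {n p θ δ b : ℝ} (hn1 : 1 ≤ n) (hp2 : 2 ≤ p) (hθ0 : 0 < θ)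
    (hθ1 : θ < 1) (hδ : 0 < δ) (hb : 0.2307 * n ≤ b) (hδ1 : δ ≤ 25.6 * θ)
    (hδ2 : δ ≤ 161288 * (θ * √n * Real.exp (-(Real.log p ^ 2 / 4)))) :
    0 ≤ -(p * δ ^ 2 / ((10 ^ 12 : ℝ) * θ)) + n ^ 2 * Real.log (60 * p * (b / δ)) := by
  have hp0 : 0 < p := by linarith
  set L := Real.log p with hLdef
  have hlog : 0.07 ≤ Real.log (60 * p * (b / δ)) := by
    have hge : 1.08 ≤ 60 * p * (b / δ) := by
      have hq : 0.00901 ≤ b / δ := by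
        rw [le_div_iff₀ hδ]
        norm_num at hδ1 hb ⊢
        linarith
      have := mul_le_mul hp2 hq (by norm_num) hp0.le
      norm_num at this ⊢
      linarith
    refine le_trans ?_ (Real.log_le_log (by norm_num) hge)
    refine le_trans ?_ (Real.one_sub_inv_le_log_of_pos (by norm_num))
    norm_num
  have hpexp : p * Real.exp (-(L ^ 2 / 2)) ≤ 2 := by
    have hpL : p = Real.exp L := (Real.exp_log hp0).symm
    rw [hpL, ← Real.exp_add]
    refine (Real.exp_le_exp.2 ?_).trans exp_half_le
    nlinarith [sq_nonneg (L - 1)]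
  have hsq : p * δ ^ 2 / ((10 ^ 12 : ℝ) * θ) ≤ 0.07 * n := by
    have h3 := pow_le_pow_left₀ hδ.le hδ2 2
    have h4 : (161288 * (θ * √n * Real.exp (-(L ^ 2 / 4)))) ^ 2
        = 161288 ^ 2 * (θ * θ * n * Real.exp (-(L ^ 2 / 2))) := by
      rw [mul_pow, mul_pow, mul_pow, Real.sq_sqrt (by positivity), ← Real.exp_nat_mul]
      have : ((2 : ℕ) : ℝ) * -(L ^ 2 / 4) = -(L ^ 2 / 2) := by push_cast; ring
      rw [this]
      ring
    rw [h4] at h3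
    rw [div_le_iff₀ (by positivity)]
    have h5 : p * δ ^ 2 ≤ 161288 ^ 2 * θ * θ * n * 2 := by
      calc p * δ ^ 2 ≤ p * (161288 ^ 2 * (θ * θ * n * Real.exp (-(L ^ 2 / 2)))) := by gcongr
        _ = 161288 ^ 2 * θ * θ * n * (p * Real.exp (-(L ^ 2 / 2))) := by ring
        _ ≤ _ := by gcongr
    have h6 : θ * (θ * n) ≤ 1 * (θ * n) := by gcongr
    have h7 : 0 ≤ θ * n := by positivity
    norm_num at h5 ⊢
    nlinarith
  have h8 : n ≤ n ^ 2 := by nlinarith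
  have h9 : n ^ 2 * 0.07 ≤ n ^ 2 * Real.log (60 * p * (b / δ)) := by gcongr
  norm_num at h9 hsq ⊢
  linarith

theorem explicit_tail_bound (hn : 1 ≤ n) (hp : 2 ≤ p) (hθ : 0 < θ) (hθ1 : θ < 1) {δ : ℝ} (hδ : 0 < δ)
    (hX : IsBernoulliGaussianMatrix μ θ X) :
    μ.real {ω | δ ≤ supDeviation μ X ω} <
      Real.exp (-(3 * p * δ ^ 2 / ((2580480 : ℝ) * θ + 8 * n * Real.log p ^ 4 * δ))
          + n ^ 2 * Real.log (60 * n * p * Real.log p ^ 4 / δ))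
        + Real.exp (-(p * δ ^ 2 / ((10 ^ 12 : ℝ) * θ))
          + n ^ 2 * Real.log (60 * n * p * Real.log p ^ 4 / δ))
        + 2 * n * p * θ * Real.exp (-(Real.log p ^ 2 / 2)) := by
  have hθ0 : (0 : ℝ) < θ := hθ
  have hθ1' : (θ : ℝ) < 1 := hθ1
  have hn1 : (1 : ℝ) ≤ n := by exact_mod_cast hn
  have hp2 : (2 : ℝ) ≤ p := by exact_mod_cast hp
  have hp0 : (0 : ℝ) < p := by linarith
  set L := Real.log p with hLdef
  have hL2 : 0.6931 ≤ L := by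
    have := Real.log_le_log (by norm_num) hp2
    have := Real.log_two_gt_d9
    linarith
  have hLpos : 0 < L := by linarith
  have hL4 : 0.2307 ≤ L ^ 4 :=
    le_trans (by norm_num) (pow_le_pow_left₀ (by norm_num) hL2 4)
  set C := 2 * n * p * (θ : ℝ) * Real.exp (-(L ^ 2 / 2)) with hC
  have hC0 : 0 ≤ C := by positivity
  have hb : 0.2307 * (n : ℝ) ≤ n * L ^ 4 := by nlinarith
  have harg : 60 * n * p * L ^ 4 / δ = 60 * p * (n * L ^ 4 / δ) := by ring
  rw [harg]
  set b := (n : ℝ) * L ^ 4 with hbdef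
  have hb8 : 8 * n * L ^ 4 * δ = 8 * b * δ := by rw [hbdef]; ring
  rw [hb8]
  have hbpos : 0 < b := by positivity
  set N := (n : ℝ) ^ 2 * Real.log (60 * p * (b / δ)) with hN
  rcases lt_or_ge (b + 16 / 5 * θ) δ with hbig | hsmall
  · have h := measureReal_le_supDeviation_le_of_large hn (by omega) hX hLpos.le hbig
    have h1 := Real.exp_pos (-(3 * p * δ ^ 2 / ((2580480 : ℝ) * θ + 8 * b * δ)) + N)
    have h2 := Real.exp_pos (-(p * δ ^ 2 / ((10 ^ 12 : ℝ) * θ)) + N)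
    linarith
  by_cases hβ : ∀ T ∈ unitary (EuclideanSpace ℝ (Fin n) →L[ℝ] EuclideanSpace ℝ (Fin n)),
      ∫ x, meanPowFour T x ∂(columnLaw n θ) - ∫ x, truncMeanPowFour L T x ∂(columnLaw n θ) ≤ δ / 8
  · set ε := 0.046 * δ / b with hε
    have hεpos : 0 < ε := by positivity
    have h := measureReal_le_supDeviation_le_net hn (by omega) hX hLpos (half_pos hδ) hεpos hβ
      (δ := δ) (by
        have : ε * b = 0.046 * δ := by rw [hε]; field_simp
        nlinarith)
    refine lt_of_le_of_lt h ?_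
    have h2 := Real.exp_pos (-(p * δ ^ 2 / ((10 ^ 12 : ℝ) * θ)) + N)
    have hexp : -(3 * p * (δ / 2) ^ 2 / (16 * (40320 * (θ : ℝ)) + 4 * b * (δ / 2)))
        = -(3 * p * δ ^ 2 / ((2580480 : ℝ) * θ + 8 * b * δ)) := by
      congr 1
      rw [div_eq_div_iff (by positivity) (by positivity)]
      ring
    have hcount : (1 + 2 / ε) ^ (n ^ 2) * 2 ≤ Real.exp N := by
      have hx : 1 / 14.9 ≤ b / δ := by
        rw [div_le_div_iff₀ (by norm_num) hδ]
        nlinarith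
      rw [hN, ← Nat.cast_pow, Real.exp_nat_mul, Real.exp_log (by positivity)]
      exact two_mul_net_card_le hn hp2 hbpos hδ hx
    have hmain : (1 + 2 / ε) ^ (n ^ 2) *
        (2 * Real.exp (-(3 * p * (δ / 2) ^ 2 / (16 * (40320 * (θ : ℝ)) + 4 * b * (δ / 2)))))
        ≤ Real.exp (-(3 * p * δ ^ 2 / ((2580480 : ℝ) * θ + 8 * b * δ)) + N) := by
      rw [hexp, Real.exp_add, ← mul_assoc, mul_comm (Real.exp _)]
      gcongr
    linarith
  · push Not at hβ
    obtain ⟨T, hT, hTδ⟩ := hβ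
    have h1 := integral_sub_integral_trunc_le (θ := θ) hn L hT
    have h2 := integral_sub_integral_trunc_le_exp (θ := θ) hn hLpos.le hT
    have hδ1 : δ ≤ 25.6 * θ := by linarith
    have hδ2 : δ ≤ 161288 * (θ * √n * Real.exp (-(L ^ 2 / 4))) := by linarith
    have hN0 := exponent_nonneg_of_bias hn1 hp2 hθ0 hθ1' hδ hb hδ1 hδ2
    have h3 := Real.one_le_exp hN0
    have h4 := Real.exp_pos (-(3 * p * δ ^ 2 / ((2580480 : ℝ) * θ + 8 * b * δ)) + N)
    have h5 : μ.real {ω | δ ≤ supDeviation μ X ω} ≤ 1 := measureReal_le_one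
    linarith

end ExplicitTail

section ColumnNorms

variable {n p : ℕ} {θ : unitInterval}

theorem columnLaw_real_norm_sq_gt_le (R : ℝ) :
    (columnLaw n θ).real {x | R < ‖x‖ ^ 2} ≤ Real.exp (n * θ / 2 - R / 4) := by
  have hmk := mul_meas_ge_le_integral_of_nonneg
    (Filter.Eventually.of_forall fun x => (Real.exp_pos _).le)
    (integrable_exp_quarter_norm_sq (n := n) (θ := θ)) (Real.exp (R / 4))
  rw [Real.exp_sub, le_div_iff₀ (Real.exp_pos _), mul_comm]
  refine le_trans (mul_le_mul_of_nonneg_left (measureReal_mono fun x hx => ?_)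
    (Real.exp_pos _).le) (hmk.trans integral_exp_quarter_norm_sq_le)
  rw [Set.mem_ofPred_eq] at hx ⊢
  rw [Real.exp_le_exp]
  linarith

theorem pi_real_exists_norm_sq_gt_le (R : ℝ) :
    (Measure.pi fun _ : Fin p => columnLaw n θ).real {x | ∃ j, R < ‖x j‖ ^ 2}
      ≤ p * Real.exp (n * θ / 2 - R / 4) := by
  refine (pi_real_exists_mem_le p (A := {x | R < ‖x‖ ^ 2})
    (measurableSet_lt measurable_const (by fun_prop))).trans ?_
  gcongr
  exact columnLaw_real_norm_sq_gt_le R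

theorem pi_real_sum_norm_sq_ge_le (F : ℝ) :
    (Measure.pi fun _ : Fin p => columnLaw n θ).real {x | F ≤ ∑ j, ‖x j‖ ^ 2}
      ≤ Real.exp (p * (n * θ / 2) - F / 4) := by
  have h := pi_real_sum_ge_le (ν := columnLaw n θ) p (f := fun x => ‖x‖ ^ 2 / 4)
    integrable_exp_quarter_norm_sq integral_exp_quarter_norm_sq_le (F / 4)
  simp_rw [← Finset.sum_div] at h
  refine le_trans (le_of_eq ?_) h
  congr 1
  ext x
  simp only [Set.mem_ofPred_eq]
  constructor <;> intro h <;> linarith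

end ColumnNorms

section Excess

variable {n p : ℕ} {θ : unitInterval}

/-- The vector of the excesses of `|⟪w, x j⟫|` over the level `a`. -/
noncomputable def excess (a : ℝ) (x : Fin p → EuclideanSpace ℝ (Fin n))
    (w : EuclideanSpace ℝ (Fin n)) : EuclideanSpace ℝ (Fin p) :=
  WithLp.toLp 2 fun j => max (|inner ℝ w (x j)| - a) 0

theorem norm_excess_sq (a : ℝ) (x : Fin p → EuclideanSpace ℝ (Fin n))
    (w : EuclideanSpace ℝ (Fin n)) :
    ‖excess a x w‖ ^ 2 = ∑ j, max (|inner ℝ w (x j)| - a) 0 ^ 2 := by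
  simp [EuclideanSpace.norm_sq_eq, excess]

theorem norm_le_norm_of_nonneg_of_le {v w : EuclideanSpace ℝ (Fin p)} (h0 : ∀ j, 0 ≤ v j)
    (h : ∀ j, v j ≤ w j) : ‖v‖ ≤ ‖w‖ := by
  rw [EuclideanSpace.norm_eq, EuclideanSpace.norm_eq]
  refine Real.sqrt_le_sqrt (Finset.sum_le_sum fun j _ => ?_)
  rw [Real.norm_of_nonneg (h0 j), Real.norm_of_nonneg ((h0 j).trans (h j))]
  exact pow_le_pow_left₀ (h0 j) (h j) 2

theorem excess_le_of_near (a : ℝ) (x : Fin p → EuclideanSpace ℝ (Fin n))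
    (w w' : EuclideanSpace ℝ (Fin n)) :
    ‖excess a x w‖ ≤ ‖excess (a / 2) x w'‖ + 1 / 2 * ‖excess a x ((2 : ℝ) • (w - w'))‖ := by
  have h : ‖excess a x w‖
      ≤ ‖excess (a / 2) x w' + (1 / 2 : ℝ) • excess a x ((2 : ℝ) • (w - w'))‖ := by
    refine norm_le_norm_of_nonneg_of_le (fun j => le_max_right _ _) fun j => ?_
    simp only [excess, PiLp.add_apply, PiLp.smul_apply, smul_eq_mul, real_inner_smul_left,
      inner_sub_left]
    set y := inner ℝ w (x j)
    set z := inner ℝ w' (x j)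
    have h1 : |y| ≤ |z| + |y - z| := by
      have := abs_add_le z (y - z)
      rwa [add_sub_cancel] at this
    have h2 := le_max_left (|z| - a / 2) 0
    have h3 := le_max_left (|2 * (y - z)| - a) 0
    rw [abs_mul, abs_two] at h3 ⊢
    have h4 := le_max_right (|z| - a / 2) 0
    have h5 := le_max_right (2 * |y - z| - a) 0
    exact max_le (by linarith) (by linarith)
  refine h.trans ((norm_add_le _ _).trans ?_)
  rw [norm_smul]
  norm_num

theorem norm_excess_le_of_net {a : ℝ} (ha : 0 ≤ a) (x : Fin p → EuclideanSpace ℝ (Fin n))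
    {s : Finset (EuclideanSpace ℝ (Fin n))}
    (hs : ∀ w : EuclideanSpace ℝ (Fin n), ‖w‖ ≤ 1 → ∃ w' ∈ s, ‖w - w'‖ ≤ 1 / 2) {M : ℝ}
    (hM : ∀ w ∈ s, ‖excess (a / 2) x w‖ ≤ M) {w : EuclideanSpace ℝ (Fin n)} (hw : ‖w‖ ≤ 1) :
    ‖excess a x w‖ ≤ 2 * M := by
  set K : Set ℝ := (fun v => ‖excess a x v‖) '' {v | ‖v‖ ≤ 1} with hK
  have hne : K.Nonempty := ⟨_, w, hw, rfl⟩
  have hbdd : BddAbove K := by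
    refine ⟨‖(WithLp.toLp 2 fun j => ‖x j‖ : EuclideanSpace ℝ (Fin p))‖, ?_⟩
    rintro _ ⟨v, hv, rfl⟩
    refine norm_le_norm_of_nonneg_of_le (fun j => le_max_right _ _) fun j => ?_
    simp only [excess]
    refine max_le ?_ (norm_nonneg _)
    have h1 := abs_real_inner_le_norm v (x j)
    have h2 : ‖v‖ * ‖x j‖ ≤ 1 * ‖x j‖ := mul_le_mul_of_nonneg_right hv (norm_nonneg _)
    linarith
  have hle : sSup K ≤ M + 1 / 2 * sSup K := by
    refine csSup_le hne ?_
    rintro _ ⟨v, hv, rfl⟩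
    obtain ⟨w', hw's, hvw'⟩ := hs v hv
    refine (excess_le_of_near a x v w').trans (add_le_add (hM w' hw's) ?_)
    gcongr
    refine le_csSup hbdd ⟨_, ?_, rfl⟩
    rw [Set.mem_ofPred_eq, norm_smul]
    norm_num
    linarith
  have : ‖excess a x w‖ ≤ sSup K := le_csSup hbdd ⟨w, hw, rfl⟩
  linarith

theorem pi_real_norm_excess_sq_ge_le {w : EuclideanSpace ℝ (Fin n)} (hw : ‖w‖ ≤ 1) {a : ℝ}
    (ha : 0 ≤ a) (u : ℝ) :
    (Measure.pi fun _ : Fin p => columnLaw n θ).real {x | u ≤ ‖excess a x w‖ ^ 2}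
      ≤ Real.exp (p * (3 / 2 * Real.exp (-(a ^ 2 / 8))) - u / 8) := by
  have h := pi_real_sum_ge_le (ν := columnLaw n θ) p
    (f := fun x => max (|inner ℝ w x| - a) 0 ^ 2 / 8)
    (integrable_exp_eighth_sq_excess hw ha) (integral_exp_eighth_sq_excess_le hw ha) (u / 8)
  simp_rw [← Finset.sum_div] at h
  refine le_trans (le_of_eq ?_) h
  congr 1
  ext x
  simp only [Set.mem_ofPred_eq, norm_excess_sq]
  constructor <;> intro h <;> linarith

/-- The fourth powers above the level `(2 a) ^ 4` are controlled by the excesses over `a`. -/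
theorem pow_four_sub_min_le_excess (y : ℝ) {a : ℝ} (ha : 0 ≤ a) :
    y ^ 4 - min (y ^ 4) ((2 * a) ^ 4) ≤ 4 * y ^ 2 * max (|y| - a) 0 ^ 2 := by
  rcases le_total (y ^ 4) ((2 * a) ^ 4) with h | h
  · rw [min_eq_left h, sub_self]; positivity
  · rw [← Even.pow_abs (by decide : Even 4) y] at h
    have hy := (pow_le_pow_iff_left₀ (by positivity) (abs_nonneg y) (by norm_num)).1 h
    rw [Even.pow_abs (by decide : Even 4) y] at h
    rw [min_eq_right h, max_eq_left (by linarith)]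
    have h1 : y ^ 2 ≤ 4 * (|y| - a) ^ 2 := by
      rw [← sq_abs y]; nlinarith
    have h2 := mul_le_mul_of_nonneg_left h1 (sq_nonneg y)
    have h3 : 0 ≤ (2 * a) ^ 4 := by positivity
    nlinarith

theorem sum_pow_four_excess_le {x : Fin p → EuclideanSpace ℝ (Fin n)} {R : ℝ}
    (hR : ∀ j, ‖x j‖ ^ 2 ≤ R) {w : EuclideanSpace ℝ (Fin n)} (hw : ‖w‖ ≤ 1) {a : ℝ} (ha : 0 ≤ a) :
    ∑ j, ((inner ℝ w (x j)) ^ 4 - min ((inner ℝ w (x j)) ^ 4) ((2 * a) ^ 4))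
      ≤ 4 * R * ‖excess a x w‖ ^ 2 := by
  rw [norm_excess_sq, Finset.mul_sum]
  refine Finset.sum_le_sum fun j _ => (pow_four_sub_min_le_excess _ ha).trans ?_
  gcongr
  refine le_trans ?_ (hR j)
  rw [← sq_abs]
  refine pow_le_pow_left₀ (abs_nonneg _) ?_ 2
  have h1 := abs_real_inner_le_norm w (x j)
  have h2 : ‖w‖ * ‖x j‖ ≤ 1 * ‖x j‖ := mul_le_mul_of_nonneg_right hw (norm_nonneg _)
  linarith

end Excess

section Clipping

variable {n p : ℕ} {θ : unitInterval}

theorem min_pow_four_eq (y : ℝ) {B : ℝ} (hB : 0 ≤ B) : min (y ^ 4) (B ^ 4) = min |y| B ^ 4 := by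
  rw [← Even.pow_abs (by decide : Even 4) y]
  rcases le_total |y| B with h | h
  · rw [min_eq_left h, min_eq_left (pow_le_pow_left₀ (abs_nonneg y) h 4)]
  · rw [min_eq_right h, min_eq_right (pow_le_pow_left₀ hB h 4)]

theorem abs_min_pow_four_sub_le (y z : ℝ) {B : ℝ} (hB : 0 ≤ B) :
    |min (y ^ 4) (B ^ 4) - min (z ^ 4) (B ^ 4)| ≤ 4 * B ^ 3 * |y - z| := by
  rw [min_pow_four_eq y hB, min_pow_four_eq z hB]
  have hy0 : 0 ≤ min |y| B := le_min (abs_nonneg y) hB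
  have hz0 : 0 ≤ min |z| B := le_min (abs_nonneg z) hB
  have hyB : min |y| B ≤ B := min_le_right _ _
  have hzB : min |z| B ≤ B := min_le_right _ _
  have hd : |min |y| B - min |z| B| ≤ |y - z| := by
    refine (abs_min_sub_min_le_max _ _ _ _).trans ?_
    rw [sub_self, abs_zero, max_eq_left (abs_nonneg _)]
    exact abs_abs_sub_abs_le_abs_sub y z
  set a := min |y| B
  set c := min |z| B
  have hfac : a ^ 4 - c ^ 4 = (a ^ 3 + a ^ 2 * c + a * c ^ 2 + c ^ 3) * (a - c) := by ring
  rw [hfac, abs_mul, abs_of_nonneg (by positivity)]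
  have h1 : a ^ 3 + a ^ 2 * c + a * c ^ 2 + c ^ 3 ≤ B ^ 3 + B ^ 2 * B + B * B ^ 2 + B ^ 3 := by
    gcongr
  calc _ ≤ (B ^ 3 + B ^ 2 * B + B * B ^ 2 + B ^ 3) * |y - z| := by gcongr
    _ = _ := by ring

theorem integrable_min_pow_four (w : EuclideanSpace ℝ (Fin n)) (B : ℝ) :
    Integrable (fun x => min ((inner ℝ w x) ^ 4) (B ^ 4)) (columnLaw n θ) := by
  refine (integrable_const (B ^ 4)).mono' (by fun_prop) (Filter.Eventually.of_forall fun x => ?_)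
  rw [Real.norm_eq_abs, abs_of_nonneg (le_min (by positivity) (by positivity))]
  exact min_le_right _ _

theorem integral_min_pow_four_sq_le {w : EuclideanSpace ℝ (Fin n)} (hw : ‖w‖ ≤ 1) (B : ℝ) :
    ∫ x, min ((inner ℝ w x) ^ 4) (B ^ 4) ^ 2 ∂(columnLaw n θ) ≤ 40320 * θ := by
  refine le_trans (integral_mono_of_nonneg (Filter.Eventually.of_forall fun x => sq_nonneg _)
    (integrable_inner_pow w 8) (Filter.Eventually.of_forall fun x => ?_))
    (integral_inner_pow_eight_le hw)
  have h := pow_le_pow_left₀ (le_min (by positivity) (by positivity))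
    (min_le_left ((inner ℝ w x) ^ 4) (B ^ 4)) 2
  rw [← pow_mul] at h
  exact h

theorem abs_clip_sub_clip_le (w w' x : EuclideanSpace ℝ (Fin n)) {B : ℝ} (hB : 0 ≤ B) :
    |min ((inner ℝ w x) ^ 4) (B ^ 4) - min ((inner ℝ w' x) ^ 4) (B ^ 4)|
      ≤ 4 * B ^ 3 * (‖w - w'‖ * ‖x‖) := by
  refine (abs_min_pow_four_sub_le _ _ hB).trans ?_
  gcongr
  rw [← inner_sub_left]
  exact abs_real_inner_le_norm _ _

theorem abs_integral_clip_sub_le (w w' : EuclideanSpace ℝ (Fin n)) {B : ℝ} (hB : 0 ≤ B) :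
    |∫ x, min ((inner ℝ w x) ^ 4) (B ^ 4) ∂(columnLaw n θ)
        - ∫ x, min ((inner ℝ w' x) ^ 4) (B ^ 4) ∂(columnLaw n θ)|
      ≤ 4 * B ^ 3 * (‖w - w'‖ * (1 + n)) := by
  rw [← integral_sub (integrable_min_pow_four w B) (integrable_min_pow_four w' B)]
  have hi : Integrable (fun x => 4 * B ^ 3 * (‖w - w'‖ * ‖x‖)) (columnLaw n θ) :=
    (integrable_norm.const_mul _).const_mul _
  refine (norm_integral_le_of_norm_le (f := fun x => min ((inner ℝ w x) ^ 4) (B ^ 4)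
    - min ((inner ℝ w' x) ^ 4) (B ^ 4)) hi
    (Filter.Eventually.of_forall fun x => abs_clip_sub_clip_le w w' x hB)).trans ?_
  rw [integral_const_mul, integral_const_mul]
  gcongr
  exact integral_norm_le

end Clipping

section SphereTail

variable {n p : ℕ} {θ : unitInterval}
variable {Ω : Type*} [MeasurableSpace Ω] {μ : Measure Ω} [IsProbabilityMeasure μ]
  {X : Ω → Matrix (Fin n) (Fin p) ℝ}

/-- Uniform control of the rows controls the deviation of `meanPowFour`. -/
theorem abs_meanPowFour_deviation_le (hn : 0 < n) {x : Fin p → EuclideanSpace ℝ (Fin n)} {δ : ℝ}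
    (h : ∀ w : EuclideanSpace ℝ (Fin n), ‖w‖ ≤ 1 →
      |(1 / p : ℝ) * ∑ j, (inner ℝ w (x j)) ^ 4
        - ∫ y, (inner ℝ w y) ^ 4 ∂(columnLaw n θ)| ≤ δ)
    {T : EuclideanSpace ℝ (Fin n) →L[ℝ] EuclideanSpace ℝ (Fin n)}
    (hT : T ∈ unitary (EuclideanSpace ℝ (Fin n) →L[ℝ] EuclideanSpace ℝ (Fin n))) :
    |(1 / p : ℝ) * ∑ j, meanPowFour T (x j) - ∫ y, meanPowFour T y ∂(columnLaw n θ)| ≤ δ := by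
  rw [integral_meanPowFour]
  have : (1 / p : ℝ) * ∑ j, meanPowFour T (x j)
      = (1 / n : ℝ) * ∑ i, (1 / p : ℝ) * ∑ j, (inner ℝ (rowVector T i) (x j)) ^ 4 := by
    simp_rw [meanPowFour_eq]
    rw [← Finset.mul_sum, ← Finset.mul_sum, Finset.sum_comm]
    ring
  rw [this]
  exact abs_average_sub_average_le hn fun i => h _ (norm_rowVector_of_mem_unitary hT i).le

theorem abs_row_deviation_le (hp : 0 < p) {x : Fin p → EuclideanSpace ℝ (Fin n)}
    {L R u t ε : ℝ} (hL : 0 ≤ L) (hε : 0 ≤ ε) (hR0 : 0 ≤ R)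
    (hR : ∀ j, ‖x j‖ ^ 2 ≤ R)
    (hu : ∀ w : EuclideanSpace ℝ (Fin n), ‖w‖ ≤ 1 → ‖excess L x w‖ ^ 2 ≤ 4 * u)
    {w w' : EuclideanSpace ℝ (Fin n)} (hw : ‖w‖ ≤ 1) (hww' : ‖w - w'‖ ≤ ε)
    (hw' : |(1 / p : ℝ) * ∑ j, min ((inner ℝ w' (x j)) ^ 4) ((2 * L) ^ 4)
      - ∫ y, min ((inner ℝ w' y) ^ 4) ((2 * L) ^ 4) ∂(columnLaw n θ)| ≤ t) :
    |(1 / p : ℝ) * ∑ j, (inner ℝ w (x j)) ^ 4 - ∫ y, (inner ℝ w y) ^ 4 ∂(columnLaw n θ)|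
      ≤ t + 32 * L ^ 3 * ε * (2 + R + n) + 4800 * Real.exp (-(4 * L)) + 16 * R * u / p := by
  have hp' : (0 : ℝ) < p := by exact_mod_cast hp
  have hB : 0 ≤ 2 * L := by positivity
  have hxR : ∀ j, ‖x j‖ ≤ 1 + R := fun j => by
    nlinarith [hR j, sq_nonneg (‖x j‖ - 1), norm_nonneg (x j)]
  have h1 := abs_average_sub_average_le hp (f := fun j => min ((inner ℝ w (x j)) ^ 4) ((2 * L) ^ 4))
    (g := fun j => min ((inner ℝ w' (x j)) ^ 4) ((2 * L) ^ 4))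
    (C := 4 * (2 * L) ^ 3 * (ε * (1 + R))) fun j => by
      refine (abs_clip_sub_clip_le w w' (x j) hB).trans ?_
      gcongr
      exact hxR j
  have h2 := (abs_integral_clip_sub_le (θ := θ) w w' hB).trans
    (show _ ≤ 4 * (2 * L) ^ 3 * (ε * (1 + n)) by gcongr)
  have h3 := integral_pow_four_excess_le (θ := θ) hw hB
  rw [integral_sub (integrable_inner_pow w 4) (integrable_min_pow_four w _)] at h3
  have h3' := integral_mono (integrable_min_pow_four (θ := θ) w (2 * L)) (integrable_inner_pow w 4)
    fun y => min_le_left _ _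
  have h4 := sum_pow_four_excess_le hR hw hL
  rw [Finset.sum_sub_distrib] at h4
  have h4' : ∑ j, min ((inner ℝ w (x j)) ^ 4) ((2 * L) ^ 4) ≤ ∑ j, (inner ℝ w (x j)) ^ 4 :=
    Finset.sum_le_sum fun j _ => min_le_left _ _
  have h5 := hu w hw
  have h6 : (1 / p : ℝ) * ∑ j, (inner ℝ w (x j)) ^ 4
      - (1 / p : ℝ) * ∑ j, min ((inner ℝ w (x j)) ^ 4) ((2 * L) ^ 4) ≤ 16 * R * u / p := by
    rw [← mul_sub]
    calc _ ≤ (1 / p : ℝ) * (4 * R * (4 * u)) := by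
          gcongr
          exact h4.trans (by gcongr)
      _ = _ := by ring
  have h6' : (1 / p : ℝ) * ∑ j, min ((inner ℝ w (x j)) ^ 4) ((2 * L) ^ 4)
      ≤ (1 / p : ℝ) * ∑ j, (inner ℝ w (x j)) ^ 4 := by gcongr
  have h7 : 2 * (2 * L) = 4 * L := by ring
  rw [h7] at h3
  have h8 : 4 * (2 * L) ^ 3 * (ε * (1 + R)) + 4 * (2 * L) ^ 3 * (ε * (1 + n))
      = 32 * L ^ 3 * ε * (2 + R + n) := by ring
  rw [abs_le] at h1 h2 hw' ⊢
  constructor <;> linarith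

theorem measureReal_le_supDeviation_le_sphere (hn : 0 < n) (hp : 0 < p)
    (hX : IsBernoulliGaussianMatrix μ θ X) {L R u t ε δ : ℝ} (hL : 0 < L) (hR : 0 ≤ R)
    (hu : 0 ≤ u) (ht : 0 < t) (hε : 0 < ε)
    (hδ : t + 32 * L ^ 3 * ε * (2 + R + n) + 4800 * Real.exp (-(4 * L)) + 16 * R * u / p < δ) :
    μ.real {ω | δ ≤ supDeviation μ X ω}
      ≤ (1 + 2 / ε) ^ n *
          (2 * Real.exp (-(3 * p * t ^ 2 / (16 * (40320 * θ) + 4 * (2 * L) ^ 4 * t))))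
        + 5 ^ n * Real.exp (p * (3 / 2 * Real.exp (-(L ^ 2 / 32))) - u / 8)
        + p * Real.exp (n * θ / 2 - R / 4) := by
  obtain ⟨s, hsA, hscard, hs⟩ := exists_finset_net
    (A := {w : EuclideanSpace ℝ (Fin n) | ‖w‖ ≤ 1}) (fun w hw => hw) hε
  obtain ⟨r, hrA, hrcard, hr⟩ := exists_finset_net
    (A := {w : EuclideanSpace ℝ (Fin n) | ‖w‖ ≤ 1}) (fun w hw => hw)
    (show (0 : ℝ) < 1 / 2 by norm_num)
  rw [finrank_euclideanSpace_fin] at hscard hrcard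
  norm_num at hrcard
  set B : EuclideanSpace ℝ (Fin n) → Set (Fin p → EuclideanSpace ℝ (Fin n)) := fun w =>
    {x | t ≤ |(1 / p : ℝ) * ∑ j, min ((inner ℝ w (x j)) ^ 4) ((2 * L) ^ 4)
      - ∫ y, min ((inner ℝ w y) ^ 4) ((2 * L) ^ 4) ∂(columnLaw n θ)|} with hB
  set D : EuclideanSpace ℝ (Fin n) → Set (Fin p → EuclideanSpace ℝ (Fin n)) := fun w =>
    {x | u ≤ ‖excess (L / 2) x w‖ ^ 2} with hD
  refine (measureReal_le_supDeviation_le hn hp hX hδ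
    (((⋃ w ∈ s, B w) ∪ ⋃ w ∈ r, D w) ∪ {x | ∃ j, R < ‖x j‖ ^ 2}) ?_).trans
    ((measureReal_union_le _ _).trans (add_le_add ((measureReal_union_le _ _).trans
      (add_le_add ?_ ?_)) (pi_real_exists_norm_sq_gt_le R)))
  · intro x hx T hT
    simp only [Set.mem_union, Set.mem_iUnion, not_or, not_exists] at hx
    obtain ⟨⟨hx1, hx2⟩, hx3⟩ := hx
    simp only [Set.mem_ofPred_eq, not_exists, not_lt] at hx3
    have hexc : ∀ w : EuclideanSpace ℝ (Fin n), ‖w‖ ≤ 1 → ‖excess L x w‖ ^ 2 ≤ 4 * u := by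
      intro w hw
      have h := norm_excess_le_of_net hL.le x hr (M := √u) (fun v hv => by
        have := hx2 v hv
        rw [hD, Set.mem_ofPred_eq, not_le] at this
        exact Real.le_sqrt_of_sq_le this.le) hw
      have h2 := pow_le_pow_left₀ (norm_nonneg _) h 2
      rw [mul_pow, Real.sq_sqrt hu] at h2
      linarith
    refine abs_meanPowFour_deviation_le hn (fun w hw => ?_) hT
    obtain ⟨w', hw's, hww'⟩ := hs w hw
    have hnear := hx1 w' hw's
    rw [hB, Set.mem_ofPred_eq, not_le] at hnear
    exact abs_row_deviation_le hp hL.le hε.le hR hx3 hexc hw hww' hnear.le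
  · refine (measureReal_biUnion_finset_le s B).trans ?_
    have hbern : ∀ w ∈ s, (Measure.pi fun _ : Fin p => columnLaw n θ).real (B w)
        ≤ 2 * Real.exp (-(3 * p * t ^ 2 / (16 * (40320 * θ) + 4 * (2 * L) ^ 4 * t))) := fun w hw =>
      pi_real_abs_mean_sub_ge_le hp (Y := fun y => min ((inner ℝ w y) ^ 4) ((2 * L) ^ 4))
        (by fun_prop) (fun y => le_min (by positivity) (by positivity))
        (fun y => min_le_right _ _) (integral_min_pow_four_sq_le (hsA hw) _) (by positivity)
        (mul_nonneg (by norm_num) θ.2.1) ht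
    refine (Finset.sum_le_sum hbern).trans ?_
    rw [Finset.sum_const, nsmul_eq_mul]
    gcongr
  · refine (measureReal_biUnion_finset_le r D).trans ?_
    refine (Finset.sum_le_sum fun w hw =>
      pi_real_norm_excess_sq_ge_le (hrA hw) (half_pos hL).le u).trans ?_
    rw [Finset.sum_const, nsmul_eq_mul]
    have : (L / 2) ^ 2 / 8 = L ^ 2 / 32 := by ring
    rw [this]
    gcongr

/-- A tail bound which is effective for very sparse matrices: both terms of the deviation are
small. -/
theorem measureReal_le_supDeviation_le_sparse (hn : 0 < n) (hp : 0 < p)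
    (hX : IsBernoulliGaussianMatrix μ θ X) {R F δ : ℝ} (hR : 0 ≤ R) (hF : 0 ≤ F)
    (hδ : R * F / (n * p) + 16 / 5 * θ < δ) :
    μ.real {ω | δ ≤ supDeviation μ X ω}
      ≤ p * Real.exp (n * θ / 2 - R / 4) + Real.exp (p * (n * θ / 2) - F / 4) := by
  refine (measureReal_le_supDeviation_le hn hp hX hδ
    ({x | ∃ j, R < ‖x j‖ ^ 2} ∪ {x | F ≤ ∑ j, ‖x j‖ ^ 2}) ?_).trans
    ((measureReal_union_le _ _).trans
      (add_le_add (pi_real_exists_norm_sq_gt_le R) (pi_real_sum_norm_sq_ge_le F)))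
  intro x hx T hT
  simp only [Set.mem_union, Set.mem_ofPred_eq, not_or, not_exists, not_lt, not_le] at hx
  obtain ⟨hx1, hx2⟩ := hx
  have hT1 := norm_le_one_of_mem_unitary hT
  have h1 : (1 / p : ℝ) * ∑ j, meanPowFour T (x j) ≤ R * F / (n * p) := by
    have : ∑ j, meanPowFour T (x j) ≤ ∑ j, (1 / n : ℝ) * (R * ‖x j‖ ^ 2) :=
      Finset.sum_le_sum fun j _ => (meanPowFour_le hT1 (x j)).trans (by
        gcongr
        have := mul_le_mul_of_nonneg_right (hx1 j) (sq_nonneg ‖x j‖)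
        calc ‖x j‖ ^ 4 = ‖x j‖ ^ 2 * ‖x j‖ ^ 2 := by ring
          _ ≤ _ := this)
    calc _ ≤ (1 / p : ℝ) * ∑ j, (1 / n : ℝ) * (R * ‖x j‖ ^ 2) := by gcongr
      _ = (1 / p : ℝ) * ((1 / n : ℝ) * (R * ∑ j, ‖x j‖ ^ 2)) := by
        rw [← Finset.mul_sum, ← Finset.mul_sum]
      _ ≤ (1 / p : ℝ) * ((1 / n : ℝ) * (R * F)) := by gcongr
      _ = _ := by field_simp
  have h2 : 0 ≤ (1 / p : ℝ) * ∑ j, meanPowFour T (x j) :=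
    mul_nonneg (by positivity) (Finset.sum_nonneg fun j _ => meanPowFour_nonneg T _)
  have h3 := integral_meanPowFour_le (θ := θ) hn hT
  have h4 : 0 ≤ ∫ y, meanPowFour T y ∂(columnLaw n θ) := integral_nonneg (meanPowFour_nonneg T)
  have h5 : 0 ≤ R * F / (n * p) := by positivity
  have h6 := θ.2.1
  rw [abs_le]
  constructor <;> linarith

end SphereTail

section Asymptotics

/-- The regime in which the tail bounds are evaluated: `L` stands for `log p`, it is large compared
with the constants `c` and `M`, and `√p` dominates a power of `L`. -/
structure LargeRegime (c M L p : ℝ) : Prop where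
  c_pos : 0 < c
  M_pos : 0 < M
  L_ge : 10 ^ 8 ≤ L
  cL_ge : 10 ^ 8 ≤ c * L
  M_le : M ≤ c * L
  log_ge : 11520 * M ≤ c * Real.log L
  sqrt_ge : L ^ 21 ≤ √p
  exp_eq : Real.exp L = p

theorem eventually_largeRegime {c M : ℝ} (hc : 0 < c) (hM : 0 < M) :
    ∀ᶠ p : ℝ in Filter.atTop, LargeRegime c M (Real.log p) p := by
  have hlog := Real.tendsto_log_atTop
  have hpow : ∀ᶠ p : ℝ in Filter.atTop, Real.log p ^ 21 ≤ √p := by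
    have h := (isLittleO_log_rpow_rpow_atTop (s := 1 / 2) 21 (by norm_num)).bound
      (show (0 : ℝ) < 1 by norm_num)
    filter_upwards [h, Filter.eventually_ge_atTop 1] with p hp hp1
    have h0 : 0 ≤ Real.log p := Real.log_nonneg hp1
    rw [one_mul, Real.norm_of_nonneg (by positivity), Real.norm_of_nonneg (by positivity),
      ← Real.sqrt_eq_rpow] at hp
    exact_mod_cast hp
  filter_upwards [hlog.eventually_ge_atTop (10 ^ 8), hlog.eventually_ge_atTop (10 ^ 8 / c),
    hlog.eventually_ge_atTop (M / c), (hlog.comp hlog).eventually_ge_atTop (11520 * M / c), hpow,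
    Filter.eventually_gt_atTop 0] with p h1 h2 h3 h4 h5 h6
  rw [div_le_iff₀' hc] at h2 h3
  simp only [Function.comp] at h4
  rw [div_le_iff₀' hc] at h4
  exact ⟨hc, hM, h1, h2, h3, h4, h5, Real.exp_log h6⟩

namespace LargeRegime

variable {c M L p n θ δ : ℝ}

theorem L_pos (h : LargeRegime c M L p) : 0 < L := by linarith [h.L_ge]

theorem p_pos (h : LargeRegime c M L p) : 0 < p := h.exp_eq ▸ Real.exp_pos L

theorem pow_le_sqrt (h : LargeRegime c M L p) {k : ℕ} (hk : k ≤ 21) : L ^ k ≤ √p :=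
  (pow_le_pow_right₀ (by linarith [h.L_ge]) hk).trans h.sqrt_ge

theorem sqrt_large (h : LargeRegime c M L p) : 10 ^ 8 ≤ √p := by
  have := h.pow_le_sqrt (k := 1) (by norm_num)
  rw [pow_one] at this
  exact h.L_ge.trans this

theorem sqrt_le (h : LargeRegime c M L p) : √p ≤ p := by
  have h1 := Real.sq_sqrt h.p_pos.le
  have h2 := h.sqrt_large
  nlinarith

theorem p_large (h : LargeRegime c M L p) : 10 ^ 8 ≤ p := h.sqrt_large.trans h.sqrt_le

theorem p_mul_ge (h : LargeRegime c M L p) (hδ : L ^ 2 / √p ≤ δ) : L ^ 2 * √p ≤ p * δ := by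
  have hq := h.sqrt_large
  rw [div_le_iff₀ (by linarith)] at hδ
  have h1 := Real.sq_sqrt h.p_pos.le
  calc L ^ 2 * √p ≤ δ * √p * √p := by gcongr
    _ = √p ^ 2 * δ := by ring
    _ = p * δ := by rw [h1]

theorem p_mul_sq_ge (h : LargeRegime c M L p) (hδ : L ^ 2 / √p ≤ δ) : L ^ 4 ≤ p * δ ^ 2 := by
  have hq := h.sqrt_large
  rw [div_le_iff₀ (by linarith)] at hδ
  have h1 := Real.sq_sqrt h.p_pos.le
  have h2 := pow_le_pow_left₀ (by positivity) hδ 2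
  calc L ^ 4 = (L ^ 2) ^ 2 := by ring
    _ ≤ (δ * √p) ^ 2 := h2
    _ = p * δ ^ 2 := by rw [mul_pow, h1]; ring

/-- The contribution of the largest entries. -/
theorem sq_mul_theta_le (h : LargeRegime c M L p) (hn : 1 ≤ n) (hθ0 : 0 < θ) (hθ1 : θ < 1)
    (hδ0 : 0 < δ) (hδ : L ^ 2 / √p ≤ δ) (hδM : δ ≤ M) (hc : c * (θ * n ^ 2 * Real.log n) ≤ p * δ ^ 2) :
    11520 * (n ^ 2 * θ) ≤ p * δ := by
  have hpδ := h.p_mul_ge hδ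
  have hL := h.L_pos
  have hp := h.p_pos
  rcases le_or_gt n L with hnL | hnL
  · have h1 : n ^ 2 * θ ≤ L ^ 2 * 1 := by gcongr
    have h2 := mul_le_mul_of_nonneg_left h.sqrt_large (sq_nonneg L)
    nlinarith [sq_nonneg L]
  · have h1 : Real.log L ≤ Real.log n := Real.log_le_log hL hnL.le
    have h2 : 11520 * M ≤ c * Real.log n :=
      h.log_ge.trans (mul_le_mul_of_nonneg_left h1 h.c_pos.le)
    have h3 : (n ^ 2 * θ) * (11520 * M) ≤ (n ^ 2 * θ) * (c * Real.log n) :=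
      mul_le_mul_of_nonneg_left h2 (by positivity)
    have h4 : p * δ ^ 2 ≤ p * δ * M := by
      have := mul_le_mul_of_nonneg_left hδM (mul_pos hp hδ0).le
      nlinarith
    have h5 : 11520 * (n ^ 2 * θ) * M ≤ p * δ * M := by nlinarith
    exact le_of_mul_le_mul_right h5 h.M_pos

theorem excess_term_le (h : LargeRegime c M L p) (hn : 1 ≤ n) (hθ0 : 0 < θ) (hθ1 : θ < 1)
    (hδ0 : 0 < δ) (hδ : L ^ 2 / √p ≤ δ) (hδM : δ ≤ M) (hc : c * (θ * n ^ 2 * Real.log n) ≤ p * δ ^ 2)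
    (hmod : n * L ^ 6 ≤ p * δ) :
    16 * (2 * (n * θ) + 16 * L) * (8 * (2 * n + 1 + 3 * L)) / p ≤ δ / 5 := by
  have hL := h.L_pos
  have hL8 := h.L_ge
  have hp := h.p_pos
  have h1 := h.sq_mul_theta_le hn hθ0 hθ1 hδ0 hδ hδM hc
  have hpδ := h.p_mul_ge hδ
  have h2 : 103680 * (n * L) ≤ p * δ := by
    refine le_trans ?_ hmod
    have : (10 ^ 8 : ℝ) ^ 5 ≤ L ^ 5 := pow_le_pow_left₀ (by norm_num) hL8 5
    have h3 : 103680 ≤ L ^ 5 := le_trans (by norm_num) this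
    have := mul_le_mul_of_nonneg_right h3 (show 0 ≤ n * L by positivity)
    calc _ ≤ _ := this
      _ = n * L ^ 6 := by ring
  have h3 : 92160 * L ^ 2 ≤ p * δ := by
    have := mul_le_mul_of_nonneg_left h.sqrt_large (sq_nonneg L)
    nlinarith [sq_nonneg L]
  have h4 : (2 * (n * θ) + 16 * L) * (2 * n + 1 + 3 * L)
      ≤ 6 * (n ^ 2 * θ) + 54 * (n * L) + 48 * L ^ 2 := by
    have h5 : (2 * (n * θ) + 16 * L) * (2 * n + 1 + 3 * L)
        ≤ (2 * (n * θ) + 16 * L) * (3 * n + 3 * L) := by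
      gcongr ?_ * ?_
      linarith
    have h6 : n * θ * L ≤ n * 1 * L := by gcongr
    nlinarith
  rw [div_le_iff₀ hp]
  nlinarith

theorem net_term_le (h : LargeRegime c M L p) (hn : 1 ≤ n) (hθ1 : θ < 1)
    (hδ0 : 0 < δ) (hδ : L ^ 2 / √p ≤ δ) (hmod : n * L ^ 6 ≤ p * δ) :
    32 * L ^ 3 * (1 / p ^ 2) * (2 + (2 * (n * θ) + 16 * L) + n) ≤ δ / 5 := by
  have hL := h.L_pos
  have hL8 := h.L_ge
  have hp := h.p_pos
  have hpδ := h.p_mul_ge hδ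
  have h1 : 2 + (2 * (n * θ) + 16 * L) + n ≤ 20 * n + 16 * L := by nlinarith
  have h2 : n * L ^ 3 ≤ p * δ :=
    le_trans (by gcongr <;> linarith) hmod
  have h3 : L ^ 4 ≤ p * δ := by
    refine le_trans ?_ hpδ
    have := mul_le_mul_of_nonneg_left (h.pow_le_sqrt (k := 2) (by norm_num)) (sq_nonneg L)
    nlinarith
  have h5 : L ^ 3 * (2 + (2 * (n * θ) + 16 * L) + n) ≤ 36 * (p * δ) := by
    calc _ ≤ L ^ 3 * (20 * n + 16 * L) := by gcongr
      _ = 20 * (n * L ^ 3) + 16 * L ^ 4 := by ring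
      _ ≤ _ := by linarith
  have h6 : 32 * L ^ 3 * (1 / p ^ 2) * (2 + (2 * (n * θ) + 16 * L) + n)
      = 32 * (L ^ 3 * (2 + (2 * (n * θ) + 16 * L) + n)) / p ^ 2 := by ring
  rw [h6, div_le_iff₀ (by positivity)]
  have h7 := mul_le_mul_of_nonneg_right h.p_large (mul_pos hp hδ0).le
  nlinarith

theorem bias_term_le (h : LargeRegime c M L p) (hδ : L ^ 2 / √p ≤ δ) :
    4800 * Real.exp (-(4 * L)) ≤ δ / 5 := by
  have hp := h.p_pos
  have h1 : Real.exp (-(4 * L)) = 1 / p ^ 4 := by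
    rw [Real.exp_neg, ← h.exp_eq, ← Real.exp_nat_mul, one_div]
    norm_num
  rw [h1, mul_one_div, div_le_iff₀ (by positivity)]
  have h2 : 1 ≤ p * δ := by
    refine le_trans ?_ (h.p_mul_ge hδ)
    have := h.sqrt_large
    have := h.L_ge
    nlinarith
  have h3 : (10 ^ 8 : ℝ) ^ 3 ≤ p ^ 3 := pow_le_pow_left₀ (by norm_num) h.p_large 3
  have h4 := mul_le_mul h3 h2 zero_le_one (by positivity)
  have h5 : δ / 5 * p ^ 4 = p ^ 3 * (p * δ) / 5 := by ring
  rw [h5]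
  norm_num at h4 ⊢
  linarith

theorem bernstein_exponent_ge (h : LargeRegime c M L p) (hn : 1 ≤ n) (hθ0 : 0 < θ) (hθ1 : θ < 1)
    (hδ0 : 0 < δ) (hδ : L ^ 2 / √p ≤ δ) (hc : c * (θ * n ^ 2 * Real.log n) ≤ p * δ ^ 2)
    (hmod : n * L ^ 6 ≤ p * δ) :
    6 * n * L ≤ 3 * p * (δ / 4) ^ 2 / (16 * (40320 * θ) + 4 * (2 * L) ^ 4 * (δ / 4)) := by
  have hL := h.L_pos
  have hL8 := h.L_ge
  have hp := h.p_pos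
  have h4 := h.p_mul_sq_ge hδ
  have h1 : 1024 * (n * L ^ 5 * δ) ≤ p * δ ^ 2 := by
    calc 1024 * (n * L ^ 5 * δ) ≤ L * (n * L ^ 5 * δ) := by gcongr; linarith
      _ = n * L ^ 6 * δ := by ring
      _ ≤ p * δ * δ := by gcongr
      _ = _ := by ring
  have h2 : 10 ^ 8 * (θ * n * L) ≤ p * δ ^ 2 := by
    rcases le_or_gt n (L ^ 2) with hnL | hnL
    · calc 10 ^ 8 * (θ * n * L) ≤ L * (1 * L ^ 2 * L) := by gcongr
        _ = L ^ 4 := by ring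
        _ ≤ _ := h4
    · have hlogn : 1 ≤ Real.log n := by
        rw [Real.le_log_iff_exp_le (by linarith)]
        have := Real.exp_one_lt_d9
        nlinarith
      calc 10 ^ 8 * (θ * n * L) ≤ (c * L) * (θ * n * L) := by gcongr; exact h.cL_ge
        _ = c * (θ * n * L ^ 2) := by ring
        _ ≤ c * (θ * n * n) := by have := h.c_pos; gcongr
        _ = c * (θ * n ^ 2 * 1) := by ring
        _ ≤ c * (θ * n ^ 2 * Real.log n) := by have := h.c_pos; gcongr
        _ ≤ _ := hc
  rw [le_div_iff₀ (by positivity)]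
  have h5 : 6 * n * L * (16 * (40320 * θ) + 4 * (2 * L) ^ 4 * (δ / 4))
      = 3870720 * (θ * n * L) + 96 * (n * L ^ 5 * δ) := by ring
  have h6 : 3 * p * (δ / 4) ^ 2 = 3 / 16 * (p * δ ^ 2) := by ring
  rw [h5, h6]
  have h7 : 0 ≤ p * δ ^ 2 := by positivity
  linarith

/-- For very large `n` the matrix is so sparse that both terms of the deviation are negligible. -/
theorem sparse_condition (h : LargeRegime c M L p) (hn : 1 ≤ n) (hθ0 : 0 < θ)
    (hδ0 : 0 < δ) (hδ : L ^ 2 / √p ≤ δ) (hδM : δ ≤ M) (hc : c * (θ * n ^ 2 * Real.log n) ≤ p * δ ^ 2)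
    (hbig : p * δ < n * L ^ 6) :
    (2 * (n * θ) + 16 * L) * (2 * (p * (n * θ)) + 16 * L) / (n * p) + 16 / 5 * θ < δ := by
  have hL := h.L_pos
  have hL8 := h.L_ge
  have hp := h.p_pos
  have hc0 := h.c_pos
  have hq := h.sqrt_large
  have hpδ := h.p_mul_ge hδ
  have hpδ0 : 0 < p * δ := by positivity
  have hlogn : 1 ≤ Real.log n := by
    rw [Real.le_log_iff_exp_le (by linarith)]
    refine Real.exp_one_lt_d9.le.trans ?_
    have h1 : L ^ 7 ≤ √p := h.pow_le_sqrt (by norm_num)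
    have h2 : L ^ 9 < n * L ^ 6 := by
      calc L ^ 9 = L ^ 2 * L ^ 7 := by ring
        _ ≤ L ^ 2 * √p := by gcongr
        _ ≤ p * δ := hpδ
        _ < _ := hbig
    have h3 : L ^ 3 * L ^ 6 < n * L ^ 6 := by rw [← pow_add]; exact h2
    have h4 := lt_of_mul_lt_mul_right h3 (by positivity)
    have h5 : L ≤ L ^ 3 := le_self_pow₀ (by linarith) (by norm_num)
    norm_num at hL8 ⊢
    linarith
  have hc1 : c * (θ * n ^ 2) ≤ p * δ ^ 2 := by
    calc c * (θ * n ^ 2) = c * (θ * n ^ 2 * 1) := by ring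
      _ ≤ c * (θ * n ^ 2 * Real.log n) := by gcongr
      _ ≤ _ := hc
  have hnθ : n * θ ≤ L ^ 7 := by
    have h1 : c * (n * θ) * (p * δ) ≤ (c * L ^ 7) * (p * δ) := by
      calc c * (n * θ) * (p * δ) ≤ c * (n * θ) * (n * L ^ 6) := by gcongr
        _ = c * (θ * n ^ 2) * L ^ 6 := by ring
        _ ≤ p * δ ^ 2 * L ^ 6 := by gcongr
        _ = δ * (L ^ 6 * (p * δ)) := by ring
        _ ≤ (c * L) * (L ^ 6 * (p * δ)) := by gcongr; exact hδM.trans h.M_le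
        _ = _ := by ring
    exact le_of_mul_le_mul_left (le_of_mul_le_mul_right h1 hpδ0) hc0
  have hpθ : p * θ ≤ L ^ 13 := by
    have h1 : c * (p * θ) * (p * δ ^ 2) ≤ (c * L ^ 13) * (p * δ ^ 2) := by
      calc c * (p * θ) * (p * δ ^ 2) = c * θ * (p * δ) ^ 2 := by ring
        _ ≤ c * θ * (n * L ^ 6) ^ 2 := by gcongr
        _ = c * (θ * n ^ 2) * L ^ 12 := by ring
        _ ≤ p * δ ^ 2 * L ^ 12 := by gcongr
        _ = 1 * L ^ 12 * (p * δ ^ 2) := by ring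
        _ ≤ (c * L) * L ^ 12 * (p * δ ^ 2) := by gcongr; linarith [h.cL_ge]
        _ = _ := by ring
    exact le_of_mul_le_mul_left (le_of_mul_le_mul_right h1 (by positivity)) hc0
  have hL1 : 1 ≤ L := by linarith
  have hR : 2 * (n * θ) + 16 * L ≤ L ^ 8 := by
    have h1 : L ≤ L ^ 7 := le_self_pow₀ hL1 (by norm_num)
    have h2 : 18 * L ^ 7 ≤ L * L ^ 7 := by gcongr; linarith
    calc _ ≤ 18 * L ^ 7 := by linarith
      _ ≤ _ := h2
      _ = _ := by ring
  have hF : (2 * (p * (n * θ)) + 16 * L) / (n * p) ≤ L ^ 14 / p := by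
    rw [div_le_div_iff₀ (by positivity) hp]
    have h1 : L ≤ L ^ 13 := le_self_pow₀ hL1 (by norm_num)
    have h2 : 18 * L ^ 13 ≤ L * L ^ 13 := by gcongr; linarith
    have h3 : 2 * (p * (n * θ)) + 16 * L ≤ n * L ^ 14 := by
      calc 2 * (p * (n * θ)) + 16 * L ≤ n * (2 * (p * θ)) + n * (16 * L) := by nlinarith
        _ = n * (2 * (p * θ) + 16 * L) := by ring
        _ ≤ n * (L * L ^ 13) := by gcongr; linarith
        _ = _ := by ring
    calc _ ≤ (n * L ^ 14) * p := by gcongr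
      _ = _ := by ring
  have hθp : 16 / 5 * θ ≤ L ^ 14 / p := by
    rw [le_div_iff₀ hp]
    have h2 : 18 * L ^ 13 ≤ L * L ^ 13 := by gcongr; linarith
    have h3 : L * L ^ 13 = L ^ 14 := by ring
    have h4 : 0 ≤ L ^ 13 := by positivity
    linarith
  have hprod : (2 * (n * θ) + 16 * L) * (2 * (p * (n * θ)) + 16 * L) / (n * p) ≤ L ^ 22 / p := by
    rw [mul_div_assoc]
    calc _ ≤ L ^ 8 * (L ^ 14 / p) := by gcongr
      _ = _ := by ring
  have hfin : L ^ 22 / p + L ^ 14 / p < L ^ 2 / √p := by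
    rw [← add_div, div_lt_div_iff₀ hp (by linarith)]
    have h1 : L ^ 14 ≤ L ^ 22 := pow_le_pow_right₀ hL1 (by norm_num)
    have h2 := h.sqrt_ge
    have h3 : 2 * L ^ 22 < L ^ 2 * L ^ 21 := by
      have : L ^ 2 * L ^ 21 = L * L ^ 22 := by ring
      rw [this]
      gcongr
      linarith
    calc (L ^ 22 + L ^ 14) * √p ≤ (2 * L ^ 22) * √p := by gcongr; linarith
      _ < (L ^ 2 * L ^ 21) * √p := by gcongr
      _ ≤ L ^ 2 * √p * √p := by gcongr
      _ = L ^ 2 * p := by rw [mul_assoc, Real.mul_self_sqrt hp.le]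
  linarith

end LargeRegime

end Asymptotics

section Conclusion

variable {n p : ℕ} {θ : unitInterval} {c M δ : ℝ}
variable {Ω : Type*} [MeasurableSpace Ω] {μ : Measure Ω} [IsProbabilityMeasure μ]
  {X : Ω → Matrix (Fin n) (Fin p) ℝ}

theorem measureReal_le_supDeviation_lt_inv (h : LargeRegime c M (Real.log p) p) (hn : 1 ≤ n)
    (hθ0 : 0 < θ) (hθ1 : θ < 1) (hδ0 : 0 < δ) (hδ : Real.log p ^ 2 / √p ≤ δ) (hδM : δ ≤ M)
    (hc : c * (θ * n ^ 2 * Real.log n / δ ^ 2) ≤ p) (hX : IsBernoulliGaussianMatrix μ θ X) :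
    μ.real {ω | δ ≤ supDeviation μ X ω} < 1 / p := by
  have hθ0' : (0 : ℝ) < θ := hθ0
  have hθ1' : (θ : ℝ) < 1 := hθ1
  have hn1 : (1 : ℝ) ≤ n := by exact_mod_cast hn
  have hp0 := h.p_pos
  have hp : 0 < p := by exact_mod_cast hp0
  set L := Real.log p with hLdef
  have hL := h.L_pos
  have hL8 := h.L_ge
  have hc' : c * (θ * n ^ 2 * Real.log n) ≤ p * δ ^ 2 := by
    rwa [← mul_div_assoc, div_le_iff₀ (by positivity)] at hc
  have hexp : ∀ k : ℕ, Real.exp (-(k * L)) = 1 / (p : ℝ) ^ k := fun k => by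
    rw [Real.exp_neg, Real.exp_nat_mul, h.exp_eq, one_div]
  have hfin : 4 * Real.exp (-(3 * L)) < 1 / p := by
    have := hexp 3
    push_cast at this
    rw [this, mul_one_div, div_lt_div_iff₀ (by positivity) hp0]
    have := h.p_large
    nlinarith [sq_nonneg (p : ℝ)]
  have hR0 : 0 ≤ 2 * ((n : ℝ) * θ) + 16 * L := by positivity
  have hcol : p * Real.exp (n * θ / 2 - (2 * (n * θ) + 16 * L) / 4) = Real.exp (-(3 * L)) := by
    nth_rewrite 1 [← h.exp_eq]
    rw [← Real.exp_add]
    congr 1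
    ring
  rcases le_or_gt (n * L ^ 6) (p * δ) with hmod | hbig
  · have h1 := h.excess_term_le hn1 hθ0' hθ1' hδ0 hδ hδM hc' hmod
    have h2 := h.net_term_le hn1 hθ1' hδ0 hδ hmod
    have h3 := h.bias_term_le hδ
    have h4 := h.bernstein_exponent_ge hn1 hθ0' hθ1' hδ0 hδ hc' hmod
    have hmain := measureReal_le_supDeviation_le_sphere hn hp hX (L := L)
      (R := 2 * (n * θ) + 16 * L) (u := 8 * (2 * n + 1 + 3 * L)) (t := δ / 4)
      (ε := 1 / (p : ℝ) ^ 2) (δ := δ) hL hR0 (by positivity) (by positivity) (by positivity)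
      (by linarith)
    have hA : (1 + 2 / (1 / (p : ℝ) ^ 2)) ^ n *
        (2 * Real.exp (-(3 * p * (δ / 4) ^ 2
          / (16 * (40320 * (θ : ℝ)) + 4 * (2 * L) ^ 4 * (δ / 4))))) ≤ 2 * Real.exp (-(3 * L)) := by
      have hb : 1 + 2 / (1 / (p : ℝ) ^ 2) ≤ Real.exp (3 * L) := by
        have : Real.exp (3 * L) = (p : ℝ) ^ 3 := by
          have := Real.exp_nat_mul L 3
          rw [h.exp_eq] at this
          exact_mod_cast this
        rw [this, div_div_eq_mul_div, div_one]
        have := h.p_large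
        nlinarith [sq_nonneg (p : ℝ)]
      calc _ ≤ Real.exp (3 * L) ^ n * (2 * Real.exp (-(6 * n * L))) := by gcongr
        _ = 2 * Real.exp (n * (3 * L) - 6 * n * L) := by
          rw [← Real.exp_nat_mul, sub_eq_add_neg, Real.exp_add]; ring
        _ ≤ _ := by
          gcongr
          nlinarith
    have hB : 5 ^ n * Real.exp (p * (3 / 2 * Real.exp (-(L ^ 2 / 32)))
        - 8 * (2 * n + 1 + 3 * L) / 8) ≤ Real.exp (-(3 * L)) := by
      have h5 : (5 : ℝ) ≤ Real.exp 2 := by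
        have := Real.exp_one_gt_d9
        have h6 : Real.exp 2 = Real.exp 1 ^ 2 := by rw [← Real.exp_nat_mul]; norm_num
        rw [h6]
        nlinarith
      have h7 : p * (3 / 2 * Real.exp (-(L ^ 2 / 32))) ≤ 1 := by
        nth_rewrite 1 [← h.exp_eq]
        have h8 : Real.exp L * Real.exp (-(L ^ 2 / 32)) ≤ Real.exp (-1) := by
          rw [← Real.exp_add]
          refine Real.exp_le_exp.2 ?_
          nlinarith
        have h9 : Real.exp (-1) ≤ 1 / 2 := by
          rw [Real.exp_neg, ← one_div]
          have := Real.exp_one_gt_d9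
          gcongr
          linarith
        linarith
      calc _ ≤ Real.exp 2 ^ n * Real.exp (1 - 8 * (2 * n + 1 + 3 * L) / 8) := by gcongr
        _ = Real.exp (-(3 * L)) := by
          rw [← Real.exp_nat_mul, ← Real.exp_add]
          congr 1
          ring
    rw [hcol] at hmain
    linarith
  · have hmain := measureReal_le_supDeviation_le_sparse hn hp hX (R := 2 * (n * θ) + 16 * L)
      (F := 2 * (p * (n * θ)) + 16 * L) (δ := δ) hR0 (by positivity)
      (h.sparse_condition hn1 hθ0' hδ0 hδ hδM hc' hbig)
    have hF : Real.exp (p * (n * θ / 2) - (2 * (p * (n * θ)) + 16 * L) / 4)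
        ≤ Real.exp (-(3 * L)) := by
      gcongr
      linarith
    rw [hcol] at hmain
    have := Real.exp_pos (-(3 * L))
    linarith

theorem exists_threshold (hc : 0 < c) (hM : 0 < M) :
    ∃ p₀ : ℕ, ∀ p : ℕ, p₀ ≤ p → LargeRegime c M (Real.log p) p := by
  have h := tendsto_natCast_atTop_atTop.eventually (eventually_largeRegime hc hM)
  exact Filter.eventually_atTop.1 h

end Conclusion
theorem lemma2p2 :
    -- the explicit tail bound
    (∃ c₁ c₂ : ℝ, 10 ^ 4 < c₁ ∧ 3360 < c₂ ∧
      ∀ (n p : ℕ) (θ : unitInterval) (δ : ℝ), 1 ≤ n → 2 ≤ p → 0 < θ → θ < 1 → 0 < δ →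
      ∀ {Ω : Type*} [MeasurableSpace Ω] (μ : Measure Ω) [IsProbabilityMeasure μ]
        (X : Ω → Matrix (Fin n) (Fin p) ℝ), IsBernoulliGaussianMatrix μ θ X →
        μ.real {ω | δ ≤ supDeviation μ X ω} <
          Real.exp (-(3 * p * δ ^ 2 / (c₁ * θ + 8 * n * Real.log p ^ 4 * δ))
              + n ^ 2 * Real.log (60 * n * p * Real.log p ^ 4 / δ))
            + Real.exp (-(p * δ ^ 2 / (c₂ * θ))
              + n ^ 2 * Real.log (60 * n * p * Real.log p ^ 4 / δ))
            + 2 * n * p * θ * Real.exp (-(Real.log p ^ 2 / 2))) ∧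
    -- for fixed `δ`: the probability is `< 1/p` when `p = Ω(θ n² ln n / δ²)`
    (∀ c δ : ℝ, 0 < c → 0 < δ → ∃ p₀ : ℕ,
      ∀ (n p : ℕ) (θ : unitInterval), 1 ≤ n → p₀ ≤ p → 0 < θ → θ < 1 →
      c * (θ * n ^ 2 * Real.log n / δ ^ 2) ≤ p →
      ∀ {Ω : Type*} [MeasurableSpace Ω] (μ : Measure Ω) [IsProbabilityMeasure μ]
        (X : Ω → Matrix (Fin n) (Fin p) ℝ), IsBernoulliGaussianMatrix μ θ X →
        μ.real {ω | δ ≤ supDeviation μ X ω} < 1 / p) ∧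
    -- the same uniformly in `δ`, which may vary with `p`
    (∀ c M : ℝ, 0 < c → 0 < M → ∃ p₀ : ℕ,
      ∀ (n p : ℕ) (θ : unitInterval) (δ : ℝ), 1 ≤ n → p₀ ≤ p → 0 < θ → θ < 1 →
      0 < δ → Real.log p ^ 2 / Real.sqrt p ≤ δ → δ ≤ M →
      c * (θ * n ^ 2 * Real.log n / δ ^ 2) ≤ p →
      ∀ {Ω : Type*} [MeasurableSpace Ω] (μ : Measure Ω) [IsProbabilityMeasure μ]
        (X : Ω → Matrix (Fin n) (Fin p) ℝ), IsBernoulliGaussianMatrix μ θ X →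
        μ.real {ω | δ ≤ supDeviation μ X ω} < 1 / p) := by
  refine ⟨⟨2580480, 10 ^ 12, by norm_num, by norm_num, ?_⟩, ?_, ?_⟩
  · intro n p θ δ hn hp hθ0 hθ1 hδ Ω _ μ _ X hX
    exact explicit_tail_bound hn hp hθ0 hθ1 hδ hX
  · intro c δ hc hδ
    obtain ⟨p₁, hp₁⟩ := exists_threshold hc hδ
    have hlim : Filter.Tendsto (fun p : ℕ => Real.log p ^ 2 / √p) Filter.atTop (nhds 0) := by
      have h := (isLittleO_log_rpow_rpow_atTop (s := 1 / 2) 2 (by norm_num)).tendsto_div_nhds_zero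
      refine (h.comp tendsto_natCast_atTop_atTop).congr fun p => ?_
      simp [Real.sqrt_eq_rpow]
    obtain ⟨p₂, hp₂⟩ := Filter.eventually_atTop.1 (hlim.eventually_le_const hδ)
    refine ⟨max p₁ p₂, fun n p θ hn hp hθ0 hθ1 hcp Ω _ μ _ X hX => ?_⟩
    exact measureReal_le_supDeviation_lt_inv (hp₁ p (le_trans (le_max_left _ _) hp)) hn hθ0 hθ1 hδ
      (hp₂ p (le_trans (le_max_right _ _) hp)) le_rfl hcp hX
  · intro c M hc hM
    obtain ⟨p₀, hp₀⟩ := exists_threshold hc hM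
    exact ⟨p₀, fun n p θ δ hn hp hθ0 hθ1 hδ0 hδ hδM hcp Ω _ μ _ X hX =>
      measureReal_le_supDeviation_lt_inv (hp₀ p hp) hn hθ0 hθ1 hδ0 hδ hδM hcp hX⟩
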